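/- **Theorem (rationality of $f^E_h$, energetic model).** For an integer $h\ge 1$ let $\mathcal G_h$ be the grid graph on $\mathbb N\times\{0,\dots,h-1\}$ (where $0\in\mathbb N$), in which two points are adjacent when their distance is $1$. A growing self-avoiding walk (GSAW) on $\mathcal G_h$ is a finite directed walk that visits no vertex twice and is trapped, i.e. every neighbour of its last vertex lies on the walk. For a GSAW $W$ let $|W|$ be its number of edges and $\|W\|$ its displacement, the difference between the largest and the smallest $x$-coordinate of its vertices. Let $C>0$. If a partially built walk $G$ has endpoint $v$, and $w$ is an unvisited neighbour of $v$, the energy of $w$ is $E(w)=C^{\ell}$, where $\ell$ is the number of neighbours of $w$ that are vertices of $G$, not counting $v$. In the energetic model, the next vertex is $w$ with probability $E(w)\big/\sum_{w'}E(w')$, the sum being over all unvisited neighbours $w'$ of $v$. The probability $p^E_h(W)$ of a GSAW $W$ is the product of the probabilities of its steps. Then, for every $h\ge 1$, the generating function $$f^E_h(x,y,C)=\sum_{W}p^E_h(W)\,x^{|W|}y^{\|W\|},$$ where $W$ ranges over the GSAWs on $\mathcal G_h$ that start at the top-left corner $(0,h-1)$, is rational. That is, there are polynomials $P,Q\in\mathbb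 Q[x,y,C]$ such that for every real $C>0$ one has $Q(0,0,C)\neq 0$ and $$Q(x,y,C)\, f^E_h(x,y,C)=P(x,y,C)$$ as formal power series in $x$ and $y$ with real coefficients. -/

import Mathlib

open Finset

noncomputable section

namespace GSAW

/-- The grid graph on a set `S` of integer points of the plane: the vertices are the points of
`S`, with an edge between any two points at (Euclidean) distance `1`. -/
def gridGraph (S : Set (ℤ × ℤ)) : SimpleGraph S where
  Adj u v := (u.1.1 - v.1.1) ^ 2 + (u.1.2 - v.1.2) ^ 2 = 1
  symm := ⟨fun u v h => by rw [← h]; ring⟩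
  loopless := ⟨fun u h => by simp at h⟩

/-- The points `ℕ × {0, …, h - 1}` of the half-infinite strip of height `h`. -/
def strip (h : ℕ) : Set (ℤ × ℤ) := {p | 0 ≤ p.1 ∧ 0 ≤ p.2 ∧ p.2 < h}

/-- The top-left corner `(0, h - 1)` of the half-infinite strip of height `h ≥ 1`. -/
def corner (h : ℕ) (hh : 1 ≤ h) : strip h :=
  ⟨(0, (h : ℤ) - 1), by
    show (0 : ℤ) ≤ 0 ∧ (0 : ℤ) ≤ (h : ℤ) - 1 ∧ (h : ℤ) - 1 < h
    omega⟩

theorem finite_neighborSet (S : Set (ℤ × ℤ)) (v : S) : ((gridGraph S).neighborSet v).Finite := by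
  have hfin : (Set.Icc (v.1.1 - 1, v.1.2 - 1) (v.1.1 + 1, v.1.2 + 1)).Finite :=
    Set.finite_Icc _ _
  refine (hfin.preimage (f := (Subtype.val : S → ℤ × ℤ)) Subtype.val_injective.injOn).subset
    fun w hw => ?_
  have h1 : (v.1.1 - w.1.1) ^ 2 + (v.1.2 - w.1.2) ^ 2 = 1 := hw
  have ha : (v.1.1 - w.1.1) ^ 2 ≤ 1 := by nlinarith [sq_nonneg (v.1.2 - w.1.2)]
  have hb : (v.1.2 - w.1.2) ^ 2 ≤ 1 := by nlinarith [sq_nonneg (v.1.1 - w.1.1)]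
  rw [sq_le_one_iff_abs_le_one, abs_le] at ha hb
  simp only [Set.mem_preimage, Set.mem_Icc, Prod.le_def]
  omega

instance gridGraph_locallyFinite (S : Set (ℤ × ℤ)) : (gridGraph S).LocallyFinite :=
  fun v => (finite_neighborSet S v).fintype

variable {V : Type*}

/-- A growing self-avoiding walk (GSAW) on `G` starting at `v`: a finite directed walk that visits
no vertex twice and is trapped, i.e. every neighbour of its last vertex lies on the walk. -/
structure Gsaw (G : SimpleGraph V) (v : V) where
  last : V
  walk : G.Walk v last
  isPath : walk.IsPath
  trapped : ∀ w, G.Adj last w → w ∈ walk.support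

section Energetic

variable [DecidableEq V] (G : SimpleGraph V) [G.LocallyFinite]

/-- The energy `C ^ ℓ` of a vertex `w` when the vertices of the partially built walk are those of
`A` and its endpoint is `v`; here `ℓ` is the number of neighbours of `w` in `A` other than `v`. -/
def energy (C : ℝ) (A : Finset V) (v w : V) : ℝ :=
  C ^ #{u ∈ G.neighborFinset w | u ∈ A ∧ u ≠ v}

/-- The probability that the next vertex is `w`, when the vertices of the partially built walk are
those of `A` and its endpoint is `v`: the energy of `w` divided by the total energy of
all unvisited neighbours of `v`. -/
def stepProb (C : ℝ) (A : Finset V) (v w : V) : ℝ :=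
  energy G C A v w / ∑ w' ∈ G.neighborFinset v with w' ∉ A, energy G C A v w'

variable {G}

/-- The vertices visited by the walk `p` during its first `i` steps (including its start). -/
def visited {u v : V} (p : G.Walk u v) (i : ℕ) : Finset V :=
  (range (i + 1)).image p.getVert

/-- The probability of a GSAW under the energetic model: the product of the probabilities of
its steps. -/
def energeticProb (C : ℝ) {v : V} (W : Gsaw G v) : ℝ :=
  ∏ i ∈ range W.walk.length,
    stepProb G C (visited W.walk i) (W.walk.getVert i) (W.walk.getVert (i + 1))

end Energetic

/-- The displacement of a walk on a grid graph: the difference between the largest and the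
smallest `x`-coordinate of its vertices. -/
def displacement {S : Set (ℤ × ℤ)} {u v : S} (p : (gridGraph S).Walk u v) : ℕ :=
  (p.support.toFinset.sup' ⟨u, by simp⟩ (fun w => w.1.1) -
    p.support.toFinset.inf' ⟨u, by simp⟩ (fun w => w.1.1)).toNat

/-- The GSAWs on the grid graph of `S` from `v` with `n` edges and displacement `k`. -/
def gsawsWith (S : Set (ℤ × ℤ)) (v : S) (n k : ℕ) : Set (Gsaw (gridGraph S) v) :=
  {W | W.walk.length = n ∧ displacement W.walk = k}

theorem finite_walks_length [DecidableEq V] (G : SimpleGraph V) [G.LocallyFinite] (n : ℕ) (v : V) :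
    {p : Σ u, G.Walk v u | p.2.length = n}.Finite := by
  induction n generalizing v with
  | zero =>
    refine (Set.finite_singleton (⟨v, .nil⟩ : Σ u, G.Walk v u)).subset ?_
    rintro ⟨u, p⟩ hp
    cases p with
    | nil => rfl
    | cons h q => simp at hp
  | succ n ih =>
    have hf : (⋃ w : G.neighborSet v, (fun p : Σ u, G.Walk w.1 u =>
        (⟨p.1, .cons w.2 p.2⟩ : Σ u, G.Walk v u)) '' {p | p.2.length = n}).Finite :=
      Set.finite_iUnion fun w => (ih w.1).image _
    refine hf.subset ?_
    rintro ⟨u, p⟩ hp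
    cases p with
    | nil => simp at hp
    | cons h q =>
      simp only [Set.mem_iUnion]
      refine ⟨⟨_, h⟩, ⟨u, q⟩, ?_, rfl⟩
      simpa using hp

/-- Only finitely many GSAWs have a given length and displacement, so that the finite sum in
`energeticGF` below is meaningful. -/
theorem finite_gsawsWith (S : Set (ℤ × ℤ)) (v : S) (n k : ℕ) : (gsawsWith S v n k).Finite := by
  have hinj : Function.Injective
      (fun W : Gsaw (gridGraph S) v => (⟨W.last, W.walk⟩ : Σ u, (gridGraph S).Walk v u)) := by
    rintro ⟨l, p, _, _⟩ ⟨l', p', _, _⟩ h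
    simp only [Sigma.mk.injEq] at h
    obtain ⟨rfl, h⟩ := h
    obtain rfl := eq_of_heq h
    rfl
  exact ((finite_walks_length (gridGraph S) n v).preimage hinj.injOn).subset fun W hW => hW.1

/-- The generating function `f_h(x, y, C) = ∑_W p(W) x^|W| y^‖W‖` of the GSAWs `W` on the
half-infinite strip of height `h` that start in the top-left corner, weighted by their
probability under the energetic model with constant `C`, as a formal power series over `ℝ` in
the variables `x` (index `0`) and `y` (index `1`): its coefficient at `x^n y^k` is the sum of the
probabilities of all such GSAWs with `n` edges and displacement `k`. -/
def energeticGF (h : ℕ) (hh : 1 ≤ h) (C : ℝ) : MvPowerSeries (Fin 2) ℝ := fun d =>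
  ∑ W ∈ (finite_gsawsWith (strip h) (corner h hh) (d 0) (d 1)).toFinset, energeticProb C W

/-- The polynomial `P(x, y, C) ∈ ℝ[x, y]` obtained from `P ∈ ℚ[C][x, y]` by giving `C` a real
value. -/
def specialize (C : ℝ) (P : MvPolynomial (Fin 2) (Polynomial ℚ)) : MvPolynomial (Fin 2) ℝ :=
  P.map (Polynomial.aeval C : Polynomial ℚ →ₐ[ℚ] ℝ).toRingHom

end GSAW

end

/-! The proof is a transfer-matrix argument that removes one column at a time. Cut a walk at a
column and keep its points from that column on, in order of visit. The result is a trace: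
consecutive points are adjacent, or both lie in the cut column because the walk made an excursion to
the left in between. Each point of a walk contributes one factor, a step probability or, at the end,
the indicator of being trapped. Apart from the next point, this factor depends only on earlier
points within two columns, since energies look at neighbours of neighbours. Five columns therefore
suffice to weigh the points of the middle one.

A nonempty trace amounts to its window (the part in columns 0 to 4) together with the trace from
column 1 on, provided the two agree on columns 1 to 4 (`sum_traces_succ`). The two lists interleave
in exactly one way because no step joins column 0 to a column beyond 4. Weights and numbers of
points split accordingly (`traceWeight_eq`, `countP_two_le`).

Sort traces by their part in columns 0 to 3; these parts form a finite set of states. The generating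
functions of the states satisfy a linear system R = b + yWR (`traceGF_eq`) whose coefficients are
polynomial in x and rational in C. As det(1 - yW) has constant term 1, Cramer's rule solves it
rationally. One more window, at the left wall, expresses the series of all walks through these
solutions (`energeticGF_eq`). The denominators in C are nonempty sums of powers of C, hence nonzero
for C > 0; `rationalFamilies` records that one pair P, Q serves every such C. -/

noncomputable section

namespace GSAW

/-! ### Traces of walks on vertical slabs -/

/-- The four unit steps of the square grid. -/
def dirs : Finset (ℤ × ℤ) := {(1, 0), (-1, 0), (0, 1), (0, -1)}

theorem mem_dirs {e : ℤ × ℤ} :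
    e ∈ dirs ↔ e = (1, 0) ∨ e = (-1, 0) ∨ e = (0, 1) ∨ e = (0, -1) := by
  simp [dirs]

/-- Adjacency in the square grid. -/
def GridAdj (a b : ℤ × ℤ) : Prop := b - a ∈ dirs

theorem gridAdj_iff {a b : ℤ × ℤ} : GridAdj a b ↔
    (b.1 = a.1 + 1 ∧ b.2 = a.2) ∨ (b.1 = a.1 - 1 ∧ b.2 = a.2) ∨
    (b.1 = a.1 ∧ b.2 = a.2 + 1) ∨ (b.1 = a.1 ∧ b.2 = a.2 - 1) := by
  simp only [GridAdj, mem_dirs, Prod.ext_iff, Prod.fst_sub, Prod.snd_sub]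
  omega

theorem GridAdj.fst_le {a b : ℤ × ℤ} (h : GridAdj a b) : b.1 ≤ a.1 + 1 ∧ a.1 ≤ b.1 + 1 := by
  rw [gridAdj_iff] at h
  omega

/-- Consecutive points of the trace of a walk on the half plane to the right of column `j`: they
are adjacent, or the walk makes an excursion to the left of column `j` between them. -/
def LeftRel (j : ℤ) (a b : ℤ × ℤ) : Prop := GridAdj a b ∨ (a.1 = j ∧ b.1 = j)

/-- Relations between grid adjacency and `LeftRel 0`. -/
structure IsStepRel (R : ℤ × ℤ → ℤ × ℤ → Prop) : Prop where
  of_adj : ∀ a b, GridAdj a b → R a b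
  leftRel : ∀ a b, R a b → LeftRel 0 a b

theorem isStepRel_gridAdj : IsStepRel GridAdj := ⟨fun _ _ h => h, fun _ _ h => .inl h⟩

theorem isStepRel_leftRel : IsStepRel (LeftRel 0) := ⟨fun _ _ h => .inl h, fun _ _ h => h⟩

/-- Consecutive points of the restriction of an `R`-chain to the columns up to `4`. -/
def WindowRel (R : ℤ × ℤ → ℤ × ℤ → Prop) (a b : ℤ × ℤ) : Prop := R a b ∨ (a.1 = 4 ∧ b.1 = 4)

/-- The part of a list of points in the columns up to `j`. -/
def upTo (j : ℤ) (r : List (ℤ × ℤ)) : List (ℤ × ℤ) := r.filter fun v => v.1 ≤ j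

/-- The part of a list of points in the columns from `1` on. -/
def tailPart (r : List (ℤ × ℤ)) : List (ℤ × ℤ) := r.filter fun v => 1 ≤ v.1

/-- The last retained point `m'` is either the current point or, during an excursion beyond column
4, the point of column 4 where it began. Since steps change the column by at most one, the excursion
returns through column 4. -/
theorem isChain_upTo {R : ℤ × ℤ → ℤ × ℤ → Prop} (hR : IsStepRel R) (r : List (ℤ × ℤ)) :
    ∀ m m' : ℤ × ℤ, (m.1 ≤ 4 ∧ m' = m ∨ 5 ≤ m.1 ∧ m'.1 = 4) →
      (m :: r).IsChain R → (m' :: upTo 4 r).IsChain (WindowRel R) := by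
  induction r with
  | nil => intros; simp [upTo]
  | cons v r ih =>
    intro m m' hm hc
    rw [List.isChain_cons_cons] at hc
    have h1 := hR.leftRel _ _ hc.1
    by_cases hv : v.1 ≤ 4
    · have : upTo 4 (v :: r) = v :: upTo 4 r := by simp [upTo, hv]
      rw [this, List.isChain_cons_cons]
      refine ⟨?_, ih v v (.inl ⟨hv, rfl⟩) hc.2⟩
      rcases hm with ⟨_, rfl⟩ | ⟨h5, h4⟩
      · exact .inl hc.1
      · right
        rcases h1 with h1 | h1
        · have := h1.fst_le; omega
        · omega
    · have : upTo 4 (v :: r) = upTo 4 r := by simp [upTo, hv]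
      rw [this]
      refine ih v m' (.inr ⟨by omega, ?_⟩) hc.2
      rcases hm with ⟨_, rfl⟩ | ⟨h5, h4⟩
      · rcases h1 with h1 | h1
        · have := h1.fst_le; omega
        · omega
      · exact h4

/-- The mirror image of `isChain_upTo`: excursions into columns up to 0 leave and re-enter through
column 1. The invariant also allows a chain that starts in column 0, with a fictitious `m'` in
column 1. -/
theorem isChain_tailPart {R : ℤ × ℤ → ℤ × ℤ → Prop} (hR : IsStepRel R) (r : List (ℤ × ℤ)) :
    ∀ m m' : ℤ × ℤ, (1 ≤ m.1 ∧ m' = m ∨ m.1 ≤ 0 ∧ m'.1 = 1) →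
      (m :: r).IsChain R → (m' :: tailPart r).IsChain (LeftRel 1) := by
  induction r with
  | nil => intros; simp [tailPart]
  | cons v r ih =>
    intro m m' hm hc
    rw [List.isChain_cons_cons] at hc
    have h1 := hR.leftRel _ _ hc.1
    by_cases hv : 1 ≤ v.1
    · have : tailPart (v :: r) = v :: tailPart r := by simp [tailPart, hv]
      rw [this, List.isChain_cons_cons]
      refine ⟨?_, ih v v (.inl ⟨hv, rfl⟩) hc.2⟩
      rcases h1 with h1 | h1
      · rcases hm with ⟨_, rfl⟩ | ⟨h5, h4⟩
        · exact .inl h1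
        · have := h1.fst_le
          exact .inr ⟨h4, by omega⟩
      · omega
    · have : tailPart (v :: r) = tailPart r := by simp [tailPart, hv]
      rw [this]
      refine ih v m' (.inr ⟨by omega, ?_⟩) hc.2
      rcases hm with ⟨_, rfl⟩ | ⟨h5, h4⟩
      · rcases h1 with h1 | h1
        · have := h1.fst_le; omega
        · omega
      · exact h4

/-- A chain is determined by its restrictions to the columns up to `4` and from `1` on. -/
theorem eq_of_upTo_eq_of_tailPart_eq {R : ℤ × ℤ → ℤ × ℤ → Prop} (hR : IsStepRel R)
    (r₁ : List (ℤ × ℤ)) : ∀ (r₂ : List (ℤ × ℤ)) (m : ℤ × ℤ),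
      (m :: r₁).IsChain R → (m :: r₂).IsChain R →
      upTo 4 r₁ = upTo 4 r₂ → tailPart r₁ = tailPart r₂ → r₁ = r₂ := by
  -- Different heads must be seen by different restrictions: one by the left only, the other by the
  -- right only.
  have key : ∀ v w : ℤ × ℤ, ∀ l₁ l₂, upTo 4 (v :: l₁) = upTo 4 (w :: l₂) →
      tailPart (v :: l₁) = tailPart (w :: l₂) → v = w ∨ (v.1 ≤ 0 ∧ 5 ≤ w.1) ∨
        (w.1 ≤ 0 ∧ 5 ≤ v.1) := by
    intro v w l₁ l₂ h1 h2
    by_cases a : v.1 ≤ 4 <;> by_cases b : w.1 ≤ 4 <;> by_cases c : 1 ≤ v.1 <;>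
      by_cases d : 1 ≤ w.1 <;> simp [upTo, tailPart, a, b, c, d] at h1 h2 <;>
      first
      | exact .inl h1.1
      | exact .inl h2.1
      | (right; omega)
  -- A common predecessor would have to lie both in a column up to 1 and in a column from 4 on.
  have hsplit : ∀ {m a b : ℤ × ℤ}, R m a → R m b → a.1 ≤ 0 → 5 ≤ b.1 → False := by
    intro m a b h1 h2 ha hb
    rcases hR.leftRel _ _ h1 with h1 | h1 <;> rcases hR.leftRel _ _ h2 with h2 | h2
    · have := h1.fst_le; have := h2.fst_le; omega
    · omega
    · have := h2.fst_le; omega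
    · omega
  have hnil : ∀ (v : ℤ × ℤ) l, upTo 4 (v :: l) = [] → tailPart (v :: l) = [] → False := by
    intro v l h1 h2
    simp only [upTo, tailPart, List.filter_eq_nil_iff] at h1 h2
    have := h1 v (by simp)
    have := h2 v (by simp)
    simp at *
    omega
  induction r₁ with
  | nil =>
    intro r₂ m _ _ h3 h4
    cases r₂ with
    | nil => rfl
    | cons w r₂ => exact (hnil w r₂ h3.symm h4.symm).elim
  | cons v r₁ ih =>
    intro r₂ m h1 h2 h3 h4
    cases r₂ with
    | nil => exact (hnil v r₁ h3 h4).elim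
    | cons w r₂ =>
      rw [List.isChain_cons_cons] at h1 h2
      rcases key v w r₁ r₂ h3 h4 with rfl | h | h
      · congr 1
        refine ih r₂ v h1.2 h2.2 ?_ ?_
        · by_cases a : v.1 ≤ 4 <;> simpa [upTo, a] using h3
        · by_cases a : 1 ≤ v.1 <;> simpa [tailPart, a] using h4
      · exact (hsplit h1.1 h2.1 h.1 h.2).elim
      · exact (hsplit h2.1 h1.1 h.1 h.2).elim

/-- Two compatible traces, on the columns up to `4` and from `1` on, can be merged. -/
theorem exists_merge {R : ℤ × ℤ → ℤ × ℤ → Prop} (hR : IsStepRel R) (n : ℕ) :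
    ∀ (t r : List (ℤ × ℤ)) (a c m : ℤ × ℤ), t.length + r.length = n →
      (m = a ∧ a.1 = 0 ∧ c.1 = 1 ∨ m = c ∧ 5 ≤ c.1 ∧ a.1 = 4 ∨
        m = a ∧ m = c ∧ 1 ≤ m.1 ∧ m.1 ≤ 4) →
      (∀ v ∈ t, 0 ≤ v.1 ∧ v.1 ≤ 4) → (∀ v ∈ r, 1 ≤ v.1) →
      (a :: t).IsChain (WindowRel R) → (c :: r).IsChain (LeftRel 1) →
      tailPart t = upTo 4 r →
      ∃ l, (m :: l).IsChain R ∧ upTo 4 l = t ∧ tailPart l = r := by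
  -- Here `a` and `c` are the last points read from the two lists and `m` is the last merged point.
  -- The merge is greedy: a head of `t` in column 0 or a head of `r` beyond column 4 is taken alone;
  -- otherwise both heads lie in the overlap and coincide.
  induction n using Nat.strong_induction_on with
  | _ n ih =>
  intro t r a c m hn hinv ht hr hct hcr hf
  by_cases hA : ∃ x t₁, t = x :: t₁ ∧ x.1 = 0
  · obtain ⟨x, t₁, rfl, hx⟩ := hA
    rw [List.isChain_cons_cons] at hct
    have h0 : R a x := by
      rcases hct.1 with h | h
      · exact h
      · omega
    have h1 := hR.leftRel _ _ h0
    have h2 : m = a ∧ c.1 = 1 := by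
      rcases h1 with h1 | h1
      · have := h1.fst_le
        rcases hinv with h | h | ⟨rfl, rfl, h⟩
        · exact ⟨h.1, h.2.2⟩
        · omega
        · exact ⟨rfl, by omega⟩
      · rcases hinv with h | h | ⟨rfl, rfl, h⟩
        · exact ⟨h.1, h.2.2⟩
        · omega
        · omega
    obtain ⟨l, hl1, hl2, hl3⟩ := ih (t₁.length + r.length) (by rw [← hn]; simp) t₁ r x c x rfl
      (.inl ⟨rfl, hx, h2.2⟩) (fun v hv => ht v (by simp [hv])) hr hct.2 hcr
      (by rw [← hf]; simp [tailPart, hx])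
    refine ⟨x :: l, ?_, ?_, ?_⟩
    · rw [List.isChain_cons_cons, h2.1]
      exact ⟨h0, hl1⟩
    · rw [← hl2]; simp [upTo, hx]
    · rw [← hl3]; simp [tailPart, hx]
  by_cases hC : ∃ x r₁, r = x :: r₁ ∧ 5 ≤ x.1
  · obtain ⟨x, r₁, rfl, hx⟩ := hC
    rw [List.isChain_cons_cons] at hcr
    have h0 : GridAdj c x := by
      rcases hcr.1 with h | h
      · exact h
      · omega
    have h2 := h0.fst_le
    have h3 : m = c ∧ a.1 = 4 := by
      rcases hinv with h | h | ⟨rfl, rfl, h⟩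
      · omega
      · exact ⟨h.1, h.2.2⟩
      · exact ⟨rfl, by omega⟩
    have hx4 : ¬ x.1 ≤ 4 := by omega
    obtain ⟨l, hl1, hl2, hl3⟩ := ih (t.length + r₁.length) (by rw [← hn]; simp) t r₁ a x x rfl
      (.inr (.inl ⟨rfl, hx, h3.2⟩)) ht (fun v hv => hr v (by simp [hv])) hct hcr.2
      (by rw [hf]; simp [upTo, hx4])
    refine ⟨x :: l, ?_, ?_, ?_⟩
    · rw [List.isChain_cons_cons, h3.1]
      exact ⟨hR.of_adj _ _ h0, hl1⟩
    · rw [← hl2]; simp [upTo, hx4]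
    · have h5 : 1 ≤ x.1 := by omega
      rw [← hl3]; simp [tailPart, h5]
  match t, r with
  | [], [] => exact ⟨[], by simp, rfl, rfl⟩
  | x :: t, [] =>
    have h1 := ht x (by simp)
    have h2 : x.1 ≠ 0 := fun h => hA ⟨x, t, rfl, h⟩
    have h3 : 1 ≤ x.1 := by omega
    simp [tailPart, upTo, h3] at hf
  | [], y :: r =>
    have h3 : y.1 ≤ 4 := not_lt.1 fun h => hC ⟨y, r, rfl, h⟩
    simp [tailPart, upTo, h3] at hf
  | x :: t, y :: r =>
    have h1 := ht x (by simp)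
    have h2 : x.1 ≠ 0 := fun h => hA ⟨x, t, rfl, h⟩
    have h3 : 1 ≤ x.1 := by omega
    have h4 : y.1 ≤ 4 := not_lt.1 fun h => hC ⟨y, r, rfl, h⟩
    simp only [tailPart, upTo, h3, h4, decide_true, List.filter_cons_of_pos,
      List.cons.injEq] at hf
    obtain ⟨rfl, hf⟩ := hf
    rw [List.isChain_cons_cons] at hct hcr
    -- When `m = a = c`, an excursion recorded by `t` needs column 4 and one recorded by `r` needs
    -- column 1. They cannot both occur, so one of the two relations is a genuine step.
    have h0 : R m x := by
      rcases hinv with ⟨rfl, h, h'⟩ | ⟨rfl, h⟩ | ⟨rfl, rfl, h⟩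
      · rcases hct.1 with h1 | h1
        · exact h1
        · omega
      · rcases hcr.1 with h1 | h1
        · exact hR.of_adj _ _ h1
        · omega
      · rcases hct.1 with h1 | h1
        · exact h1
        · rcases hcr.1 with h1 | h1
          · exact hR.of_adj _ _ h1
          · omega
    obtain ⟨l, hl1, hl2, hl3⟩ := ih (t.length + r.length) (by rw [← hn]; simp; omega) t r x x x rfl
      (.inr (.inr ⟨rfl, rfl, h3, h4⟩)) (fun v hv => ht v (by simp [hv]))
      (fun v hv => hr v (by simp [hv])) hct.2 hcr.2 hf
    refine ⟨x :: l, ?_, ?_, ?_⟩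
    · rw [List.isChain_cons_cons]
      exact ⟨h0, hl1⟩
    · rw [← hl2]; simp [upTo, h4]
    · rw [← hl3]; simp [tailPart, h3]

/-- `r` is a list of distinct points of the half-infinite strip of height `h` which, preceded by
the auxiliary point `m`, is an `R`-chain. -/
structure IsTrace (h : ℕ) (R : ℤ × ℤ → ℤ × ℤ → Prop) (m : ℤ × ℤ) (r : List (ℤ × ℤ)) : Prop where
  nodup : r.Nodup
  mem : ∀ v ∈ r, v ∈ strip h
  chain : (m :: r).IsChain R

/-- The restrictions of traces to the columns up to `4`. -/
structure IsWindow (h : ℕ) (R : ℤ × ℤ → ℤ × ℤ → Prop) (m : ℤ × ℤ) (t : List (ℤ × ℤ)) : Prop where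
  nodup : t.Nodup
  mem : ∀ v ∈ t, v ∈ strip h ∧ v.1 ≤ 4
  chain : (m :: t).IsChain (WindowRel R)
  ne_nil : t ≠ []

/-- A list of points has extent `k` if it lies in the columns before `k` and meets the last of
these. -/
def HasExtent (r : List (ℤ × ℤ)) (k : ℕ) : Prop :=
  (∀ v ∈ r, v.1 < k) ∧ (k ≠ 0 → ∃ v ∈ r, v.1 + 1 = k)

/-- Translation by one column to the left. -/
def shift (v : ℤ × ℤ) : ℤ × ℤ := (v.1 - 1, v.2)

/-- Translation by one column to the right. -/
def unshift (v : ℤ × ℤ) : ℤ × ℤ := (v.1 + 1, v.2)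

@[simp] theorem shift_fst (v : ℤ × ℤ) : (shift v).1 = v.1 - 1 := rfl
@[simp] theorem shift_snd (v : ℤ × ℤ) : (shift v).2 = v.2 := rfl
@[simp] theorem unshift_fst (v : ℤ × ℤ) : (unshift v).1 = v.1 + 1 := rfl
@[simp] theorem unshift_snd (v : ℤ × ℤ) : (unshift v).2 = v.2 := rfl
@[simp] theorem shift_unshift (v : ℤ × ℤ) : shift (unshift v) = v := by simp [shift, unshift]
@[simp] theorem unshift_shift (v : ℤ × ℤ) : unshift (shift v) = v := by simp [shift, unshift]

theorem shift_injective : Function.Injective shift :=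
  Function.LeftInverse.injective unshift_shift

theorem unshift_injective : Function.Injective unshift :=
  Function.LeftInverse.injective shift_unshift

/-- The part of a list of points in the columns from `1` on, translated by one to the left. -/
def next (r : List (ℤ × ℤ)) : List (ℤ × ℤ) := (tailPart r).map shift

theorem map_shift_map_unshift (r : List (ℤ × ℤ)) : (r.map unshift).map shift = r := by
  simp [Function.comp_def]

/-! ### Finiteness of the sets of traces and windows -/

theorem finite_nodup_lists {α : Type*} {s : Set α} (hs : s.Finite) :
    {l : List α | l.Nodup ∧ ∀ x ∈ l, x ∈ s}.Finite := by
  classical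
  have := hs.fintype
  have hf : {l : List s | l.length ≤ Fintype.card s}.Finite := List.finite_length_le _ _
  refine (hf.image (List.map Subtype.val)).subset ?_
  rintro l ⟨h1, h2⟩
  lift l to List s using h2
  refine ⟨l, ?_, rfl⟩
  exact (List.Nodup.of_map _ h1).length_le_card

theorem finite_strip_lt (h : ℕ) (k : ℤ) : {v : ℤ × ℤ | v ∈ strip h ∧ v.1 < k}.Finite := by
  refine (Set.finite_Icc ((0, 0) : ℤ × ℤ) (k, h)).subset ?_
  rintro v ⟨hv, hk⟩
  simp only [strip, Set.mem_ofPred_eq] at hv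
  simp only [Set.mem_Icc, Prod.le_def]
  omega

theorem finite_traces (h : ℕ) (R : ℤ × ℤ → ℤ × ℤ → Prop) (m : ℤ × ℤ) (k : ℕ) :
    {r | IsTrace h R m r ∧ HasExtent r k}.Finite :=
  (finite_nodup_lists (finite_strip_lt h k)).subset fun _ hr =>
    ⟨hr.1.nodup, fun v hv => ⟨hr.1.mem v hv, hr.2.1 v hv⟩⟩

theorem finite_windows (h : ℕ) (R : ℤ × ℤ → ℤ × ℤ → Prop) (m : ℤ × ℤ) :
    {t | IsWindow h R m t}.Finite :=
  (finite_nodup_lists (finite_strip_lt h 5)).subset fun _ ht =>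
    ⟨ht.nodup, fun v hv => ⟨(ht.mem v hv).1, by have := (ht.mem v hv).2; omega⟩⟩

/-- The finite set of traces of extent `k`. -/
def traces (h : ℕ) (R : ℤ × ℤ → ℤ × ℤ → Prop) (m : ℤ × ℤ) (k : ℕ) : Finset (List (ℤ × ℤ)) :=
  (finite_traces h R m k).toFinset

/-- The finite set of windows. -/
def windows (h : ℕ) (R : ℤ × ℤ → ℤ × ℤ → Prop) (m : ℤ × ℤ) : Finset (List (ℤ × ℤ)) :=
  (finite_windows h R m).toFinset

theorem mem_traces {h R m k r} : r ∈ traces h R m k ↔ IsTrace h R m r ∧ HasExtent r k := by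
  simp [traces]

theorem mem_windows {h R m t} : t ∈ windows h R m ↔ IsWindow h R m t := by
  simp [windows]

/-! ### Removing the leftmost column of a trace -/

theorem leftRel_shift {a b : ℤ × ℤ} : LeftRel 0 (shift a) (shift b) ↔ LeftRel 1 a b := by
  simp only [LeftRel, gridAdj_iff, shift_fst, shift_snd]
  omega

theorem mem_upTo {j : ℤ} {r : List (ℤ × ℤ)} {v : ℤ × ℤ} : v ∈ upTo j r ↔ v ∈ r ∧ v.1 ≤ j := by
  simp [upTo]

theorem mem_tailPart {r : List (ℤ × ℤ)} {v : ℤ × ℤ} : v ∈ tailPart r ↔ v ∈ r ∧ 1 ≤ v.1 := by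
  simp [tailPart]

theorem mem_next {r : List (ℤ × ℤ)} {v : ℤ × ℤ} : v ∈ next r ↔ unshift v ∈ r ∧ 0 ≤ v.1 := by
  simp only [next, List.mem_map, mem_tailPart]
  constructor
  · rintro ⟨a, ⟨h1, h2⟩, rfl⟩
    simpa using ⟨h1, h2⟩
  · rintro ⟨h1, h2⟩
    exact ⟨_, ⟨h1, by simpa using h2⟩, by simp⟩

theorem upTo_next (r : List (ℤ × ℤ)) : upTo 3 (next r) = next (upTo 4 r) := by
  simp only [next, upTo, tailPart, List.filter_map, List.filter_filter]
  congr 1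
  refine List.filter_congr fun v _ => ?_
  have : v.1 - 1 ≤ 3 ↔ v.1 ≤ 4 := by omega
  simp [Bool.and_comm, this]

theorem upTo_three_upTo (r : List (ℤ × ℤ)) : upTo 3 (upTo 4 r) = upTo 3 r := by
  simp only [upTo, List.filter_filter]
  refine List.filter_congr fun v _ => ?_
  simp only [Bool.and_eq_decide, decide_eq_true_eq, decide_eq_decide]
  omega

theorem IsTrace.next {h R m r} (hR : IsStepRel R) (hm : m.1 = 0) (hr : IsTrace h R m r) :
    IsTrace h (LeftRel 0) (0, -1) (next r) where
  nodup := (hr.nodup.filter _).map shift_injective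
  mem v hv := by
    rw [mem_next] at hv
    have := hr.mem _ hv.1
    simp only [strip, Set.mem_ofPred_eq, unshift_fst, unshift_snd] at this ⊢
    omega
  chain := by
    -- The fictitious point (1, -1) becomes the auxiliary point (0, -1) after translation. Lying
    -- just below the strip, it forces a trace to begin in column 0 and imposes nothing else.
    have h1 : ((1, -1) :: tailPart r).IsChain (LeftRel 1) :=
      isChain_tailPart hR r m (1, -1) (.inr ⟨by omega, rfl⟩) hr.chain
    have h2 : ((0, -1) :: GSAW.next r) = ((1, -1) :: tailPart r).map shift := by
      simp [GSAW.next, shift]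
    rw [h2, List.isChain_map]
    simpa only [leftRel_shift] using h1

/-- A trace starts next to its left boundary: its first point lies in a column up to 1. Nonempty
traces therefore have nonempty windows. -/
theorem IsTrace.eq_nil {h R m r} (hR : IsStepRel R) (hm : m.1 = 0) (hr : IsTrace h R m r)
    (h0 : upTo 3 r = []) : r = [] := by
  match r, hr, h0 with
  | [], _, _ => rfl
  | v :: r, hr, h0 =>
    have h1 := hR.leftRel _ _ (List.isChain_cons_cons.1 hr.chain).1
    have h2 : v.1 ≤ 1 := by
      rcases h1 with h1 | h1
      · have := h1.fst_le; omega
      · omega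
    have : v ∈ upTo 3 (v :: r) := mem_upTo.2 ⟨by simp, by omega⟩
    simp [h0] at this

theorem IsTrace.upTo {h R m r} (hR : IsStepRel R) (hm : m.1 = 0) (hr : IsTrace h R m r)
    (h0 : r ≠ []) : IsWindow h R m (upTo 4 r) where
  nodup := hr.nodup.filter _
  mem v hv := ⟨hr.mem v (mem_upTo.1 hv).1, (mem_upTo.1 hv).2⟩
  chain := isChain_upTo hR r m m (.inl ⟨by omega, rfl⟩) hr.chain
  ne_nil h1 := h0 <| hr.eq_nil hR hm <| by rw [← upTo_three_upTo, h1]; rfl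

/-- Nonemptiness matters only for `k = 0`: it separates a trace confined to column 0 from the empty
one, both of which have empty remainder. -/
theorem hasExtent_next {h R m r} {k : ℕ} (hr : IsTrace h R m r) (h0 : r ≠ []) :
    HasExtent (next r) k ↔ HasExtent r (k + 1) := by
  have hpos : ∀ v ∈ r, 0 ≤ v.1 := fun v hv => (hr.mem v hv).1
  constructor
  · rintro ⟨h1, h2⟩
    have hlt : ∀ v ∈ r, v.1 < (k + 1 : ℕ) := by
      intro v hv
      by_cases h3 : 1 ≤ v.1
      · have := h1 (shift v) (mem_next.2 ⟨by simpa using hv, by simpa using h3⟩)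
        simp at this ⊢
        omega
      · push_cast
        omega
    refine ⟨hlt, fun _ => ?_⟩
    by_cases hk : k = 0
    · obtain ⟨v, hv⟩ := List.exists_mem_of_ne_nil _ h0
      have := hlt v hv
      have := hpos v hv
      exact ⟨v, hv, by omega⟩
    · obtain ⟨v, hv, hvk⟩ := h2 hk
      exact ⟨_, (mem_next.1 hv).1, by simp [hvk]⟩
  · rintro ⟨h1, h2⟩
    constructor
    · intro v hv
      have := h1 _ (mem_next.1 hv).1
      simp at this
      omega
    · intro hk
      obtain ⟨v, hv, hvk⟩ := h2 (by omega)
      refine ⟨shift v, mem_next.2 ⟨by simpa using hv, ?_⟩, ?_⟩ <;> simp at hvk ⊢ <;> omega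

/-- Traces correspond to pairs of a window and a compatible trace with one column less. -/
theorem sum_traces_succ {M : Type*} [AddCommMonoid M] {h : ℕ} {R : ℤ × ℤ → ℤ × ℤ → Prop}
    (hR : IsStepRel R) {m : ℤ × ℤ} (hm : m.1 = 0) (k : ℕ)
    (f : List (ℤ × ℤ) → List (ℤ × ℤ) → M) :
    ∑ r ∈ traces h R m (k + 1), f (upTo 4 r) (next r) =
      ∑ t ∈ windows h R m, ∑ r ∈ traces h (LeftRel 0) (0, -1) k with upTo 3 r = next t, f t r := by
  classical
  rw [Finset.sum_sigma']
  have hne : ∀ r ∈ traces h R m (k + 1), r ≠ [] := by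
    rintro r hr rfl
    obtain ⟨v, hv, _⟩ := (mem_traces.1 hr).2.2 (by omega)
    simp at hv
  refine Finset.sum_bij (fun r _ => ⟨upTo 4 r, next r⟩) ?_ ?_ ?_ ?_
  · intro r hr
    have h1 := mem_traces.1 hr
    simp only [mem_sigma, mem_filter, mem_windows, mem_traces]
    exact ⟨h1.1.upTo hR hm (hne r hr), ⟨h1.1.next hR hm,
      (hasExtent_next h1.1 (hne r hr)).2 h1.2⟩, upTo_next r⟩
  · intro r₁ h₁ r₂ h₂ he
    simp only [Sigma.mk.injEq, heq_eq_eq] at he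
    have h₁ := mem_traces.1 h₁
    have h₂ := mem_traces.1 h₂
    refine eq_of_upTo_eq_of_tailPart_eq hR r₁ r₂ m h₁.1.chain h₂.1.chain he.1 ?_
    exact List.map_injective_iff.2 shift_injective he.2
  · rintro ⟨t, r⟩ htr
    simp only [mem_sigma, mem_filter, mem_windows, mem_traces] at htr
    obtain ⟨ht, ⟨hr, hk⟩, hc⟩ := htr
    have hr1 : ∀ v ∈ r.map unshift, 1 ≤ v.1 := by
      intro v hv
      obtain ⟨w, hw, rfl⟩ := List.mem_map.1 hv
      have := (hr.mem w hw).1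
      simpa using this
    have hc1 : ((1, -1) :: r.map unshift).IsChain (LeftRel 1) := by
      have h2 : ((1, -1) :: r.map unshift) = ((0, -1) :: r).map unshift := by
        simp [unshift]
      rw [h2, List.isChain_map]
      refine hr.chain.imp fun a b hab => ?_
      rw [← leftRel_shift]
      simpa using hab
    have hc2 : tailPart t = upTo 4 (r.map unshift) := by
      have h3 : next t = upTo 3 (next (r.map unshift)) := by
        rw [← hc, next, tailPart, List.filter_eq_self.2 (by simpa using hr1),
          map_shift_map_unshift]
      rw [upTo_next] at h3
      have h4 := List.map_injective_iff.2 shift_injective h3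
      rw [h4, tailPart, List.filter_eq_self]
      intro v hv
      simpa using hr1 v (mem_upTo.1 hv).1
    obtain ⟨l, hl1, hl2, hl3⟩ := exists_merge hR _ t (r.map unshift) m (1, -1) m rfl
      (.inl ⟨rfl, hm, rfl⟩) (fun v hv => ⟨(ht.mem v hv).1.1, (ht.mem v hv).2⟩) hr1
      ht.chain hc1 hc2
    · have hnl : next l = r := by rw [next, hl3, map_shift_map_unshift]
      have hl : IsTrace h R m l := by
        refine ⟨?_, ?_, hl1⟩
        -- Every point is seen by at least one of the two restrictions, with its full multiplicity
        -- in `l`.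
        · rw [List.nodup_iff_count_le_one]
          intro v
          by_cases h4 : v.1 ≤ 4
          · have := List.nodup_iff_count_le_one.1 ht.nodup v
            rwa [← hl2, upTo, List.count_filter (by simpa using h4)] at this
          · have := List.nodup_iff_count_le_one.1 (hr.nodup.map unshift_injective) v
            rwa [← hl3, tailPart, List.count_filter (by simp; omega)] at this
        · intro v hv
          by_cases h4 : v.1 ≤ 4
          · exact (ht.mem v (by rw [← hl2]; exact mem_upTo.2 ⟨hv, h4⟩)).1
          · have h5 : v ∈ r.map unshift := by
              rw [← hl3]; exact mem_tailPart.2 ⟨hv, by omega⟩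
            obtain ⟨w, hw, rfl⟩ := List.mem_map.1 h5
            have := hr.mem w hw
            simp only [strip, Set.mem_ofPred_eq, unshift_fst, unshift_snd] at this ⊢
            omega
      have hl0 : l ≠ [] := by
        rintro rfl
        exact ht.ne_nil hl2.symm
      refine ⟨l, mem_traces.2 ⟨hl, ?_⟩, ?_⟩
      · rw [← hasExtent_next hl hl0, hnl]
        exact hk
      · simp [hl2, hnl]
  · intros; rfl

/-! ### Weights -/

/-- The product over the splittings `l = p ++ v :: q` of `g (p.reverse ++ p₀) v q`, where `p₀` is
the first argument. -/
def scanProd {α M : Type*} [CommMonoid M] (g : List α → α → List α → M) : List α → List α → M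
  | _, [] => 1
  | p, v :: q => g p v q * scanProd g (v :: p) q

theorem scanProd_mul {α M : Type*} [CommMonoid M] (g g' : List α → α → List α → M)
    (q p : List α) :
    scanProd (fun p v q => g p v q * g' p v q) p q = scanProd g p q * scanProd g' p q := by
  induction q generalizing p with
  | nil => simp [scanProd]
  | cons v q ih => simp only [scanProd, ih]; exact mul_mul_mul_comm _ _ _ _

/-- The mechanism for localizing weights: points whose factor is 1 may be deleted once the other
factors are known not to notice. -/
theorem scanProd_filter {α M : Type*} [CommMonoid M] (P : α → Bool)
    (g g' : List α → α → List α → M) (q p : List α)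
    (H : ∀ p v q', (v :: q') <:+ q →
      g p v q' = if P v then g' (p.filter P) v (q'.filter P) else 1) :
    scanProd g p q = scanProd g' (p.filter P) (q.filter P) := by
  induction q generalizing p with
  | nil => rfl
  | cons v q ih =>
    have h1 := ih (v :: p) fun p w q' hq => H p w q' (hq.trans (List.suffix_cons v q))
    rw [scanProd, H p v q List.suffix_rfl, h1]
    by_cases hv : P v <;> simp [hv, scanProd]

theorem scanProd_map {α β M : Type*} [CommMonoid M] (σ : α → β)
    (g : List α → α → List α → M) (g' : List β → β → List β → M) (q p : List α)
    (H : ∀ p v q, g p v q = g' (p.map σ) (σ v) (q.map σ)) :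
    scanProd g p q = scanProd g' (p.map σ) (q.map σ) := by
  induction q generalizing p with
  | nil => rfl
  | cons v q ih => simp [scanProd, ih, H]

theorem scanProd_congr {α M : Type*} [CommMonoid M] {g g' : List α → α → List α → M}
    (q p : List α) (H : ∀ p v q', (v :: q') <:+ q → g p v q' = g' p v q') :
    scanProd g p q = scanProd g' p q := by
  have := scanProd_filter (fun _ => true) g g' q p (fun p v q' h => by simpa using H p v q' h)
  simpa using this

theorem scanProd_mem {α M S : Type*} [CommMonoid M] [SetLike S M] [SubmonoidClass S M] (K : S)
    (g : List α → α → List α → M) (q p : List α) (H : ∀ p v q, g p v q ∈ K) :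
    scanProd g p q ∈ K := by
  induction q generalizing p with
  | nil => exact one_mem K
  | cons v q ih => exact mul_mem (H _ _ _) (ih _)

/-- The energy of `w` when the points of the list `A` have been visited and `v` is the current
end point. -/
def latticeEnergy (C : ℝ) (A : List (ℤ × ℤ)) (v w : ℤ × ℤ) : ℝ :=
  C ^ #{e ∈ dirs | w + e ∈ A ∧ w + e ≠ v}

open scoped Classical in
/-- The steps from `v` to points of `S` outside `A`. -/
def freeDirs (S : Set (ℤ × ℤ)) (A : List (ℤ × ℤ)) (v : ℤ × ℤ) : Finset (ℤ × ℤ) :=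
  {e ∈ dirs | v + e ∈ S ∧ v + e ∉ A}

theorem mem_freeDirs {S : Set (ℤ × ℤ)} {A : List (ℤ × ℤ)} {v e : ℤ × ℤ} :
    e ∈ freeDirs S A v ↔ e ∈ dirs ∧ v + e ∈ S ∧ v + e ∉ A := by
  simp [freeDirs]

/-- The probability of a step from `v` to `w` inside `S` when the points of the list `A` have been
visited. -/
def latticeStep (S : Set (ℤ × ℤ)) (C : ℝ) (A : List (ℤ × ℤ)) (v w : ℤ × ℤ) : ℝ :=
  latticeEnergy C A v w / ∑ e ∈ freeDirs S A v, latticeEnergy C A v (v + e)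

/-- Every neighbour of `v` in `S` belongs to `p`. -/
def IsTrapped (S : Set (ℤ × ℤ)) (p : List (ℤ × ℤ)) (v : ℤ × ℤ) : Prop :=
  ∀ e ∈ dirs, v + e ∈ S → v + e ∈ p

open scoped Classical in
/-- The factor contributed by a point `v` of a walk inside `S`, when `p` lists the points before
and `q` the points after `v`: a step probability or, at the end of the walk, the indicator of
being trapped. -/
def pointWeight (S : Set (ℤ × ℤ)) (C : ℝ) (p : List (ℤ × ℤ)) (v : ℤ × ℤ) :
    List (ℤ × ℤ) → ℝ
  | [] => if IsTrapped S p v then 1 else 0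
  | w :: _ => latticeStep S C (v :: p) v w

/-! ### Locality and translation invariance of the weights -/

theorem fst_add_of_mem_dirs {v e : ℤ × ℤ} (he : e ∈ dirs) :
    v.1 - 1 ≤ (v + e).1 ∧ (v + e).1 ≤ v.1 + 1 := by
  rw [mem_dirs] at he
  rcases he with rfl | rfl | rfl | rfl <;> (simp; try omega)

theorem latticeEnergy_congr {C : ℝ} {A A' : List (ℤ × ℤ)} {v w : ℤ × ℤ}
    (h : ∀ u : ℤ × ℤ, w.1 - 1 ≤ u.1 → u.1 ≤ w.1 + 1 → (u ∈ A ↔ u ∈ A')) :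
    latticeEnergy C A v w = latticeEnergy C A' v w := by
  unfold latticeEnergy
  congr 2
  refine Finset.filter_congr fun e he => ?_
  have := fst_add_of_mem_dirs (v := w) he
  rw [h _ this.1 this.2]

theorem latticeStep_congr {S S' : Set (ℤ × ℤ)} {C : ℝ} {A A' : List (ℤ × ℤ)} {v w : ℤ × ℤ}
    (hw : v.1 - 1 ≤ w.1 ∧ w.1 ≤ v.1 + 1)
    (hS : ∀ u : ℤ × ℤ, v.1 - 1 ≤ u.1 → u.1 ≤ v.1 + 1 → (u ∈ S ↔ u ∈ S'))
    (h : ∀ u : ℤ × ℤ, v.1 - 2 ≤ u.1 → u.1 ≤ v.1 + 2 → (u ∈ A ↔ u ∈ A')) :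
    latticeStep S C A v w = latticeStep S' C A' v w := by
  unfold latticeStep
  rw [latticeEnergy_congr (A' := A') fun u _ _ => h u (by omega) (by omega)]
  congr 1
  refine Finset.sum_congr ?_ fun e he => ?_
  · ext e
    rw [mem_freeDirs, mem_freeDirs]
    refine and_congr_right fun he => ?_
    have := fst_add_of_mem_dirs (v := v) he
    rw [h _ (by omega) (by omega), hS _ (by omega) (by omega)]
  · have := fst_add_of_mem_dirs (v := v) (mem_freeDirs.1 he).1
    exact latticeEnergy_congr fun u _ _ => h u (by omega) (by omega)

/-- The ambient set is consulted only at neighbours of `v`, but energies consult the visited points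
at neighbours of those. Hence the radii of one and two columns. -/
theorem pointWeight_congr {S S' : Set (ℤ × ℤ)} {C : ℝ} {p p' : List (ℤ × ℤ)} {v : ℤ × ℤ}
    {q q' : List (ℤ × ℤ)} (hq : q.head? = q'.head?)
    (hw : ∀ w ∈ q.head?, v.1 - 1 ≤ w.1 ∧ w.1 ≤ v.1 + 1)
    (hS : ∀ u : ℤ × ℤ, v.1 - 1 ≤ u.1 → u.1 ≤ v.1 + 1 → (u ∈ S ↔ u ∈ S'))
    (h : ∀ u : ℤ × ℤ, v.1 - 2 ≤ u.1 → u.1 ≤ v.1 + 2 → (u ∈ p ↔ u ∈ p')) :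
    pointWeight S C p v q = pointWeight S' C p' v q' := by
  match q, q', hq with
  | [], [], _ =>
    have : IsTrapped S p v ↔ IsTrapped S' p' v := by
      refine forall₂_congr fun e he => ?_
      have := fst_add_of_mem_dirs (v := v) he
      rw [h _ (by omega) (by omega), hS _ (by omega) (by omega)]
    classical
    exact if_congr this rfl rfl
  | w :: q, w' :: q', hq =>
    obtain rfl : w = w' := by simpa using hq
    refine latticeStep_congr (hw w (by simp)) hS fun u h1 h2 => ?_
    simp [h u h1 h2]

theorem shift_add (v e : ℤ × ℤ) : shift v + e = shift (v + e) := by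
  ext <;> simp; ring

theorem latticeEnergy_shift (C : ℝ) (A : List (ℤ × ℤ)) (v w : ℤ × ℤ) :
    latticeEnergy C (A.map shift) (shift v) (shift w) = latticeEnergy C A v w := by
  simp only [latticeEnergy, shift_add, List.mem_map_of_injective shift_injective, ne_eq,
    shift_injective.eq_iff]

/-- The strip of height `h` that is infinite in both directions. -/
def fullStrip (h : ℕ) : Set (ℤ × ℤ) := {p | 0 ≤ p.2 ∧ p.2 < h}

theorem shift_mem_fullStrip {h : ℕ} {v : ℤ × ℤ} : shift v ∈ fullStrip h ↔ v ∈ fullStrip h :=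
  Iff.rfl

/-- Translation invariance is the reason for using the two-sided strip away from the left wall. -/
theorem pointWeight_shift (h : ℕ) (C : ℝ) (p : List (ℤ × ℤ)) (v : ℤ × ℤ) (q : List (ℤ × ℤ)) :
    pointWeight (fullStrip h) C (p.map shift) (shift v) (q.map shift) =
      pointWeight (fullStrip h) C p v q := by
  cases q with
  | nil =>
    have : IsTrapped (fullStrip h) (p.map shift) (shift v) ↔ IsTrapped (fullStrip h) p v := by
      simp only [IsTrapped, shift_add, List.mem_map_of_injective shift_injective,
        shift_mem_fullStrip]
    classical
    exact if_congr this rfl rfl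
  | cons w q =>
    have h1 := latticeEnergy_shift C (v :: p) v
    have h2 : freeDirs (fullStrip h) ((v :: p).map shift) (shift v) =
        freeDirs (fullStrip h) (v :: p) v := by
      ext e
      simp only [mem_freeDirs, shift_add, List.mem_map_of_injective shift_injective,
        shift_mem_fullStrip]
    rw [List.map_cons] at h1 h2
    simp only [List.map_cons, pointWeight, latticeStep, h1, h2, shift_add]

/-- The weight of a point in the two-sided strip if it lies in the columns from `2` on. -/
def bulkWeight (h : ℕ) (C : ℝ) (p : List (ℤ × ℤ)) (v : ℤ × ℤ) (q : List (ℤ × ℤ)) : ℝ :=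
  if 2 ≤ v.1 then pointWeight (fullStrip h) C p v q else 1

/-- The weight of a trace: the product of the weights of its points in the columns from `2` on. -/
def traceWeight (h : ℕ) (C : ℝ) (r : List (ℤ × ℤ)) : ℝ := scanProd (bulkWeight h C) [] r

/-- The product of the weights, with respect to `S`, of the points of `t` in the columns of `J`. -/
def windowWeight (S : Set (ℤ × ℤ)) (J : Finset ℤ) (C : ℝ) (t : List (ℤ × ℤ)) : ℝ :=
  scanProd (fun p v q => if v.1 ∈ J then pointWeight S C p v q else 1) [] t

/-! ### Factorization of weights over a window and the remaining columns -/

theorem head?_filter_of_chain {R : ℤ × ℤ → ℤ × ℤ → Prop} {v : ℤ × ℤ} {q : List (ℤ × ℤ)}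
    (hc : (v :: q).IsChain R) (P : ℤ × ℤ → Bool) (hP : ∀ w ∈ q, R v w → P w) :
    (q.filter P).head? = q.head? := by
  cases q with
  | nil => rfl
  | cons w q =>
    rw [List.isChain_cons_cons] at hc
    simp [hP w (by simp) hc.1]

/-- The weight of a point away from the left boundary of a trace is determined locally. -/
theorem pointWeight_filter {R : ℤ × ℤ → ℤ × ℤ → Prop} {S S' : Set (ℤ × ℤ)} {C : ℝ}
    {p : List (ℤ × ℤ)} {v : ℤ × ℤ} {q : List (ℤ × ℤ)} (P : ℤ × ℤ → Bool)
    (hc : (v :: q).IsChain R) (hv : ∀ w, R v w → GridAdj v w)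
    (hS : ∀ u : ℤ × ℤ, v.1 - 1 ≤ u.1 → u.1 ≤ v.1 + 1 → (u ∈ S ↔ u ∈ S'))
    (hP : ∀ u : ℤ × ℤ, v.1 - 2 ≤ u.1 → u.1 ≤ v.1 + 2 → P u) :
    pointWeight S C p v q = pointWeight S' C (p.filter P) v (q.filter P) := by
  refine pointWeight_congr ?_ ?_ hS ?_
  · refine (head?_filter_of_chain hc P fun w _ hR => ?_).symm
    have := (hv w hR).fst_le
    exact hP w (by omega) (by omega)
  · intro w hw
    cases q with
    | nil => simp at hw
    | cons w' q =>
      obtain rfl : w' = w := by simpa using hw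
      have := (hv _ (List.isChain_cons_cons.1 hc).1).fst_le
      omega
  · intro u h1 h2
    rw [List.mem_filter]
    exact ⟨fun hu => ⟨hu, hP u h1 h2⟩, fun hu => hu.1⟩

theorem IsTrace.isChain {h R m r} (hr : IsTrace h R m r) : r.IsChain R := hr.chain.of_cons

/-- The weight of a trace factors into a part determined by its window and the weight of the
rest. -/
theorem scanProd_pointWeight_eq {h : ℕ} {R : ℤ × ℤ → ℤ × ℤ → Prop} {m : ℤ × ℤ} (C : ℝ)
    {r : List (ℤ × ℤ)} (hR : IsStepRel R) (hr : IsTrace h R m r) {S : Set (ℤ × ℤ)}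
    (hS : ∀ u : ℤ × ℤ, 0 ≤ u.1 → (u ∈ S ↔ u ∈ fullStrip h)) {J : Finset ℤ} (hJ : ∀ j ∈ J, j ≤ 2)
    (hJR : ∀ v w : ℤ × ℤ, v.1 ∈ J → R v w → GridAdj v w) :
    scanProd (fun p v q => if v.1 ∈ J ∨ 3 ≤ v.1 then pointWeight S C p v q else 1) [] r =
      windowWeight S J C (upTo 4 r) * traceWeight h C (next r) := by
  have h1 : ∀ p v q, (if v.1 ∈ J ∨ 3 ≤ v.1 then pointWeight S C p v q else 1) =
      (if v.1 ∈ J then pointWeight S C p v q else 1) *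
        (if 3 ≤ v.1 then pointWeight S C p v q else 1) := by
    intro p v q
    by_cases hv : v.1 ∈ J
    · have := hJ _ hv
      have h3 : ¬ 3 ≤ v.1 := by omega
      simp [hv, h3]
    · simp [hv]
  simp only [h1]
  rw [scanProd_mul]
  congr 1
  · refine scanProd_filter _ _ _ r [] fun p v q hq => ?_
    by_cases hv : v.1 ∈ J
    · have h2 := hJ _ hv
      have h3 : v.1 ≤ 4 := by omega
      simp only [hv, h3, if_true, decide_true]
      exact pointWeight_filter _ (hr.isChain.suffix hq) (fun w => hJR v w hv)
        (fun _ _ _ => Iff.rfl) fun u _ _ => by simp; omega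
    · simp [hv]
  -- A point in a column from 3 on sees only columns from 1 on. It keeps its weight when column 0 is
  -- removed, does not see the wall, and lands in a column from 2 on after translation.
  · rw [scanProd_filter (fun v : ℤ × ℤ => decide (1 ≤ v.1)) _
      (fun p v q => if 3 ≤ v.1 then pointWeight (fullStrip h) C p v q else 1) r []]
    · rw [scanProd_map shift _ (bulkWeight h C)]
      · rfl
      · intro p v q
        have : 2 ≤ v.1 - 1 ↔ 3 ≤ v.1 := by omega
        simp only [bulkWeight, shift_fst, this, pointWeight_shift]
    · intro p v q hq
      by_cases hv : 3 ≤ v.1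
      · have h3 : 1 ≤ v.1 := by omega
        simp only [hv, h3, if_true, decide_true]
        refine pointWeight_filter _ (hr.isChain.suffix hq) (fun w hw => ?_)
          (fun u _ _ => hS u (by omega)) fun u _ _ => by simp; omega
        rcases hR.leftRel _ _ hw with h | h
        · exact h
        · omega
      · simp [hv]

/-- Only column 2 is charged to the window: columns 0 and 1 depend on points already cut off, and
later columns are charged to later windows. -/
theorem traceWeight_eq {h : ℕ} {m : ℤ × ℤ} (C : ℝ) {r : List (ℤ × ℤ)}
    (hr : IsTrace h (LeftRel 0) m r) :
    traceWeight h C r =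
      windowWeight (fullStrip h) {2} C (upTo 4 r) * traceWeight h C (next r) := by
  rw [← scanProd_pointWeight_eq C isStepRel_leftRel hr (fun _ _ => Iff.rfl) (J := {2}) (by simp)]
  · refine scanProd_congr r [] fun p v q _ => ?_
    refine if_congr ?_ rfl rfl
    rw [mem_singleton]
    omega
  · rintro v w hv (hw | hw)
    · exact hw
    · rw [mem_singleton] at hv
      omega

/-- For the walk itself nothing has been cut off, so the first window also pays for columns 0 and 1,
using the strip with its wall. -/
theorem scanProd_pointWeight_strip {h : ℕ} {m : ℤ × ℤ} (C : ℝ) {r : List (ℤ × ℤ)}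
    (hr : IsTrace h GridAdj m r) :
    scanProd (pointWeight (strip h) C) [] r =
      windowWeight (strip h) {0, 1, 2} C (upTo 4 r) * traceWeight h C (next r) := by
  rw [← scanProd_pointWeight_eq C isStepRel_gridAdj hr (J := {0, 1, 2}) _ (by simp)
    (fun _ _ _ h => h)]
  · refine scanProd_congr r [] fun p v q hq => ?_
    have : 0 ≤ v.1 := (hr.mem v (hq.subset (by simp))).1
    rw [if_pos]
    simp only [mem_insert, mem_singleton]
    omega
  · intro u hu
    simp [strip, fullStrip, hu]

/-! ### Splitting the number of points in the same way as the weights -/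

theorem countP_two_le (r : List (ℤ × ℤ)) :
    r.countP (fun v => 2 ≤ v.1) =
      (upTo 4 r).countP (fun v => v.1 = 2) + (next r).countP (fun v => 2 ≤ v.1) := by
  induction r with
  | nil => rfl
  | cons v r ih =>
    simp only [upTo, next, tailPart, List.countP_filter, List.countP_map,
      Function.comp_def] at ih ⊢
    simp only [List.countP_cons, ih, Bool.and_eq_true,
      decide_eq_true_eq]
    have hs := shift_fst v
    split_ifs <;> omega

theorem length_eq_countP (r : List (ℤ × ℤ)) :
    r.length =
      (upTo 4 r).countP (fun v => v.1 ≤ 2) + (next r).countP (fun v => 2 ≤ v.1) := by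
  induction r with
  | nil => rfl
  | cons v r ih =>
    simp only [upTo, next, tailPart, List.countP_filter, List.countP_map,
      Function.comp_def] at ih ⊢
    simp only [List.countP_cons, ih, List.length_cons,
      Bool.and_eq_true, decide_eq_true_eq]
    have hs := shift_fst v
    split_ifs <;> omega

/-! ### Growing self-avoiding walks as traces -/

theorem gridGraph_adj_iff {S : Set (ℤ × ℤ)} {u v : S} :
    (gridGraph S).Adj u v ↔ GridAdj u.1 v.1 := by
  have hdef : (gridGraph S).Adj u v ↔
    (u.1.1 - v.1.1) ^ 2 + (u.1.2 - v.1.2) ^ 2 = 1 := Iff.rfl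
  rw [hdef, gridAdj_iff]
  constructor
  · intro h
    have ha : (u.1.1 - v.1.1) ^ 2 ≤ 1 := by nlinarith [sq_nonneg (u.1.2 - v.1.2)]
    have hb : (u.1.2 - v.1.2) ^ 2 ≤ 1 := by nlinarith [sq_nonneg (u.1.1 - v.1.1)]
    rw [sq_le_one_iff_abs_le_one, abs_le] at ha hb
    obtain ⟨x, hx⟩ : ∃ x, x = u.1.1 - v.1.1 := ⟨_, rfl⟩
    obtain ⟨y, hy⟩ : ∃ y, y = u.1.2 - v.1.2 := ⟨_, rfl⟩
    rw [← hx] at h ha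
    rw [← hy] at h hb
    obtain ⟨hx1, hx2⟩ := ha
    obtain ⟨hy1, hy2⟩ := hb
    interval_cases x <;> interval_cases y <;> simp at h <;> omega
  · rintro (⟨h1, h2⟩ | ⟨h1, h2⟩ | ⟨h1, h2⟩ | ⟨h1, h2⟩) <;> rw [h1, h2] <;> ring

theorem latticeEnergy_eq {S : Set (ℤ × ℤ)} [DecidableEq S] (C : ℝ) (A : Finset S)
    (L : List (ℤ × ℤ)) (hL : ∀ u, u ∈ L ↔ ∃ a ∈ A, a.1 = u) (v w : S) :
    energy (gridGraph S) C A v w = latticeEnergy C L v.1 w.1 := by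
  unfold energy latticeEnergy
  congr 1
  refine Finset.card_bij (fun u _ => u.1 - w.1) ?_ ?_ ?_
  · intro u hu
    rw [mem_filter, SimpleGraph.mem_neighborFinset, gridGraph_adj_iff] at hu
    rw [mem_filter, add_sub_cancel]
    exact ⟨hu.1, (hL _).2 ⟨u, hu.2.1, rfl⟩, fun h => hu.2.2 (Subtype.ext h)⟩
  · intro u₁ _ u₂ _ h
    exact Subtype.ext (sub_left_injective h)
  · intro e he
    rw [mem_filter, hL] at he
    obtain ⟨he, ⟨a, ha, hae⟩, hev⟩ := he
    refine ⟨a, ?_, by rw [hae, add_sub_cancel_left]⟩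
    rw [mem_filter, SimpleGraph.mem_neighborFinset, gridGraph_adj_iff, GridAdj, hae,
      add_sub_cancel_left]
    refine ⟨he, ha, ?_⟩
    rintro rfl
    exact hev hae.symm

theorem latticeStep_eq {S : Set (ℤ × ℤ)} [DecidableEq S] (C : ℝ) (A : Finset S)
    (L : List (ℤ × ℤ)) (hL : ∀ u, u ∈ L ↔ ∃ a ∈ A, a.1 = u) (v w : S) :
    stepProb (gridGraph S) C A v w = latticeStep S C L v.1 w.1 := by
  unfold stepProb latticeStep
  rw [latticeEnergy_eq C A L hL]
  congr 1
  refine Finset.sum_bij (fun u _ => u.1 - v.1) ?_ ?_ ?_ ?_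
  · intro u hu
    rw [mem_filter, SimpleGraph.mem_neighborFinset, gridGraph_adj_iff] at hu
    rw [mem_freeDirs, add_sub_cancel]
    refine ⟨hu.1, u.2, fun h => hu.2 ?_⟩
    obtain ⟨a, ha, hau⟩ := (hL _).1 h
    rwa [← Subtype.ext hau]
  · intro u₁ _ u₂ _ h
    exact Subtype.ext (sub_left_injective h)
  · intro e he
    rw [mem_freeDirs, hL] at he
    refine ⟨⟨v.1 + e, he.2.1⟩, ?_, by simp⟩
    rw [mem_filter, SimpleGraph.mem_neighborFinset, gridGraph_adj_iff, GridAdj,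
      add_sub_cancel_left]
    exact ⟨he.1, fun h => he.2.2 ⟨_, h, rfl⟩⟩
  · intro u _
    rw [latticeEnergy_eq C A L hL, add_sub_cancel]

/-- The list of points of a walk. -/
def points {S : Set (ℤ × ℤ)} {u v : S} (p : (gridGraph S).Walk u v) : List (ℤ × ℤ) :=
  p.support.map Subtype.val

theorem visited_zero {V : Type*} [DecidableEq V] {G : SimpleGraph V} {u v : V}
    (p : G.Walk u v) : visited p 0 = {u} := by
  simp [visited]

theorem visited_cons_succ {V : Type*} [DecidableEq V] {G : SimpleGraph V} {u v w : V}
    (h : G.Adj u v) (p : G.Walk v w) (i : ℕ) :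
    visited (.cons h p) (i + 1) = insert u (visited p i) := by
  ext x
  simp only [visited, mem_image, mem_range, mem_insert]
  constructor
  · rintro ⟨j, hj, rfl⟩
    cases j with
    | zero => left; simp
    | succ j => right; exact ⟨j, by omega, by simp⟩
  · rintro (rfl | ⟨j, hj, rfl⟩)
    · exact ⟨0, by omega, by simp⟩
    · exact ⟨j + 1, by omega, by simp⟩

-- Induction along the walk requires an arbitrary list `L` of earlier vertices. The walk need not be
-- trapped: the final indicator lets the sum run over all self-avoiding walks.
open scoped Classical in
theorem scanProd_points {S : Set (ℤ × ℤ)} (C : ℝ) {u v : S} (p : (gridGraph S).Walk u v) :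
    ∀ L : List S, scanProd (pointWeight S C) (L.map Subtype.val) (points p) =
      (∏ i ∈ range p.length, stepProb (gridGraph S) C (L.toFinset ∪ visited p i) (p.getVert i)
        (p.getVert (i + 1))) *
      if ∀ w, (gridGraph S).Adj v w → w ∈ L ++ p.support then 1 else 0 := by
  induction p with
  | nil =>
    intro L
    rename_i u
    simp only [points, SimpleGraph.Walk.support_nil, List.map_cons, List.map_nil, scanProd,
      pointWeight, mul_one, SimpleGraph.Walk.length_nil, range_zero, prod_empty, one_mul]
    refine if_congr ?_ rfl rfl
    constructor
    · intro h w hw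
      have h1 := h (w.1 - u.1) (gridGraph_adj_iff.1 hw) (by simp)
      rw [add_sub_cancel, List.mem_map] at h1
      obtain ⟨a, ha, haw⟩ := h1
      rw [← Subtype.ext haw]
      simp [ha]
    · intro h e he heS
      have hadj : (gridGraph S).Adj u ⟨u.1 + e, heS⟩ := by
        rw [gridGraph_adj_iff, GridAdj, add_sub_cancel_left]
        exact he
      have h1 := h _ hadj
      rw [List.mem_append, List.mem_singleton] at h1
      rcases h1 with h1 | h1
      · exact List.mem_map.2 ⟨_, h1, rfl⟩
      · exact absurd h1 hadj.ne'
  | @cons u w v hadj p ih =>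
    intro L
    have hpts : ∃ q, points p = w.1 :: q := by
      rw [points, ← SimpleGraph.Walk.cons_tail_support]
      exact ⟨_, List.map_cons⟩
    obtain ⟨q, hq⟩ := hpts
    have h1 : points (.cons hadj p) = u.1 :: points p := by simp [points]
    have ih := ih (u :: L)
    rw [List.map_cons] at ih
    have h2 : pointWeight S C (L.map Subtype.val) u.1 (points p) =
        stepProb (gridGraph S) C (L.toFinset ∪ visited (.cons hadj p) 0) u w := by
      rw [hq, pointWeight]
      refine (latticeStep_eq C _ _ (fun x => ?_) u w).symm
      simp only [visited_zero, List.mem_cons, List.mem_map, mem_union, List.mem_toFinset,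
        mem_singleton, or_and_right, exists_or, exists_eq_left]
      rw [or_comm, eq_comm]
    have h3 : ∀ i, L.toFinset ∪ visited (.cons hadj p) (i + 1) =
        (u :: L).toFinset ∪ visited p i := by
      intro i
      rw [visited_cons_succ, List.toFinset_cons, insert_union, union_insert]
    have h4 : (∀ x, (gridGraph S).Adj v x → x ∈ u :: L ++ p.support) ↔
        ∀ x, (gridGraph S).Adj v x → x ∈ L ++ (SimpleGraph.Walk.cons hadj p).support := by
      refine forall₂_congr fun x _ => ?_
      simp only [List.cons_append, List.mem_cons, List.mem_append,
        SimpleGraph.Walk.support_cons]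
      exact or_left_comm
    rw [h1, scanProd, ih, h2, SimpleGraph.Walk.length_cons, prod_range_succ',
      if_congr h4 rfl rfl]
    simp only [h3, SimpleGraph.Walk.getVert_cons_succ, SimpleGraph.Walk.getVert_zero]
    ring

theorem points_injective {S : Set (ℤ × ℤ)} {v : S} :
    Function.Injective fun W : Gsaw (gridGraph S) v => points W.walk := by
  rintro ⟨l, p, hp, ht⟩ ⟨l', p', hp', ht'⟩ h
  have h1 : p.support = p'.support := List.map_injective_iff.2 Subtype.val_injective h
  obtain rfl : l = l' := by
    rw [← p.getLast_support, ← p'.getLast_support]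
    simp only [h1]
  obtain rfl := SimpleGraph.Walk.ext_support h1
  rfl

/-- The probability of a walk of the growth process: the weight of its list of points. -/
theorem energeticProb_eq {S : Set (ℤ × ℤ)} [DecidableEq S] (C : ℝ) {v : S}
    (W : Gsaw (gridGraph S) v) :
    energeticProb C W = scanProd (pointWeight S C) [] (points W.walk) := by
  classical
  have h1 := scanProd_points C W.walk []
  rw [if_pos (by simpa using W.trapped), mul_one, List.map_nil] at h1
  rw [h1, energeticProb]
  refine prod_congr rfl fun i _ => ?_
  simp only [List.toFinset_nil, empty_union]
  congr!

/-- The start in column 0 makes the smallest abscissa 0, so displacement `k` means that column `k`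
is the last of `k + 1` columns. -/
theorem hasExtent_points {h : ℕ} {u v : strip h} (hu : u.1.1 = 0) (p : (gridGraph (strip h)).Walk u v)
    (k : ℕ) : HasExtent (points p) (k + 1) ↔ displacement p = k := by
  have hmem : ∀ x, x ∈ points p ↔ ∃ w ∈ p.support, w.1 = x := by simp [points]
  have hinf : p.support.toFinset.inf' ⟨u, by simp⟩ (fun w => w.1.1) = 0 := by
    apply le_antisymm
    · rw [← hu]
      exact Finset.inf'_le _ (by simp)
    · exact Finset.le_inf' _ _ fun w _ => w.2.1
  obtain ⟨w₀, hw₀, hsup⟩ := Finset.exists_mem_eq_sup' (s := p.support.toFinset) ⟨u, by simp⟩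
    (fun w => w.1.1)
  have hle : ∀ w ∈ p.support, w.1.1 ≤ w₀.1.1 := by
    intro w hw
    rw [← hsup]
    exact Finset.le_sup' (fun w : strip h => w.1.1) (by simpa using hw)
  have h0 : 0 ≤ w₀.1.1 := w₀.2.1
  have hw₀' : w₀ ∈ p.support := by simpa using hw₀
  rw [displacement, hinf, hsup]
  constructor
  · rintro ⟨h1, h2⟩
    have h3 := h1 w₀.1 ((hmem _).2 ⟨w₀, hw₀', rfl⟩)
    obtain ⟨x, hx, hxk⟩ := h2 (by omega)
    obtain ⟨w, hw, rfl⟩ := (hmem x).1 hx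
    have := hle w hw
    push_cast at h3 hxk
    omega
  · intro hk
    refine ⟨fun x hx => ?_, fun _ => ⟨w₀.1, (hmem _).2 ⟨w₀, hw₀', rfl⟩, ?_⟩⟩
    · obtain ⟨w, hw, rfl⟩ := (hmem x).1 hx
      have := hle w hw
      push_cast
      omega
    · push_cast
      omega

/-- The auxiliary point (0, h) lies just above the strip. Its only neighbour there is the corner, so
the chain condition encodes the starting point. -/
theorem isTrace_points {h : ℕ} {hh : 1 ≤ h} {v : strip h}
    (p : (gridGraph (strip h)).Walk (corner h hh) v) (hp : p.IsPath) :
    IsTrace h GridAdj (0, (h : ℤ)) (points p) where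
  nodup := hp.support_nodup.map Subtype.val_injective
  mem x hx := by
    obtain ⟨w, _, rfl⟩ := List.mem_map.1 hx
    exact w.2
  chain := by
    have h1 : (points p).IsChain GridAdj := by
      rw [points, List.isChain_map]
      exact p.isChain_adj_support.imp fun a b => gridGraph_adj_iff.1
    have h2 : points p = (0, (h : ℤ) - 1) :: p.support.tail.map Subtype.val := by
      rw [points, ← SimpleGraph.Walk.cons_tail_support]
      rfl
    rw [h2] at h1 ⊢
    rw [List.isChain_cons_cons]
    exact ⟨by rw [gridAdj_iff]; simp, h1⟩

theorem exists_walk_of_isTrace {h : ℕ} (hh : 1 ≤ h) {r : List (ℤ × ℤ)}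
    (hr : IsTrace h GridAdj (0, (h : ℤ)) r) (hne : r ≠ []) :
    ∃ (v : strip h) (p : (gridGraph (strip h)).Walk (corner h hh) v),
      p.IsPath ∧ points p = r := by
  obtain ⟨hnd, hmem, hch⟩ := hr
  lift r to List (strip h) using hmem
  have hne' : r ≠ [] := by simpa using hne
  have hch' : r.IsChain (gridGraph (strip h)).Adj := by
    have h1 := hch.of_cons
    rw [List.isChain_map] at h1
    exact h1.imp fun a b => gridGraph_adj_iff.2
  obtain ⟨w, r, rfl⟩ := List.exists_cons_of_ne_nil hne'
  have hw : w = corner h hh := by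
    rw [List.map_cons, List.isChain_cons_cons, gridAdj_iff] at hch
    have h1 := hch.1
    have h2 := w.2
    simp only [strip, Set.mem_ofPred_eq] at h2
    refine Subtype.ext (Prod.ext ?_ ?_) <;> simp only [corner] <;> simp only at h1 <;> omega
  subst hw
  obtain ⟨v, p, hp⟩ : ∃ (v : strip h) (p : (gridGraph (strip h)).Walk (corner h hh) v),
      p.support = corner h hh :: r :=
    ⟨_, SimpleGraph.Walk.ofSupport _ hne' hch', SimpleGraph.Walk.support_ofSupport hne' hch'⟩
  refine ⟨v, p, ?_, by rw [points, hp]⟩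
  rw [SimpleGraph.Walk.isPath_def, hp]
  exact List.Nodup.of_map _ hnd

theorem energeticGF_apply (h : ℕ) (hh : 1 ≤ h) (C : ℝ) (d : Fin 2 →₀ ℕ) :
    energeticGF h hh C d =
      ∑ r ∈ traces h GridAdj (0, (h : ℤ)) (d 1 + 1) with r.length = d 0 + 1,
        scanProd (pointWeight (strip h) C) [] r := by
  classical
  unfold energeticGF
  refine Finset.sum_of_injOn (fun W => points W.walk) points_injective.injOn ?_ ?_ ?_
  · intro W hW
    simp only [Set.Finite.coe_toFinset, gsawsWith, Set.mem_ofPred_eq] at hW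
    simp only [coe_filter, Set.mem_ofPred_eq, mem_traces]
    refine ⟨⟨isTrace_points W.walk W.isPath, (hasExtent_points rfl _ _).2 hW.2⟩, ?_⟩
    simp [points, hW.1]
  · intro r hr hr'
    simp only [mem_filter, mem_traces] at hr
    obtain ⟨⟨hr, hk⟩, hl⟩ := hr
    obtain ⟨v, p, hp, rfl⟩ := exists_walk_of_isTrace hh hr (by rintro rfl; simp at hl)
    -- A trace that does not come from a GSAW is a walk that is not trapped, and has weight 0.
    rw [← List.map_nil (f := Subtype.val), scanProd_points, if_neg, mul_zero]
    intro ht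
    refine hr' ⟨⟨v, p, hp, by simpa using ht⟩, ?_, rfl⟩
    simp only [Set.Finite.coe_toFinset, gsawsWith, Set.mem_ofPred_eq]
    exact ⟨by simpa [points] using hl, (hasExtent_points rfl _ _).1 hk⟩
  · intro W _
    exact energeticProb_eq C W

/-! ### Rational families of power series -/

/-- The positive real numbers. -/
abbrev Pos : Type := {C : ℝ // 0 < C}

/-- The power series over `ℝ` in `x` and `y`. -/
abbrev Series : Type := MvPowerSeries (Fin 2) ℝ

/-- `specialize` as a ring homomorphism into the ring of power series. -/
def specializeHom (C : ℝ) : MvPolynomial (Fin 2) (Polynomial ℚ) →+* Series :=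
  MvPolynomial.coeToMvPowerSeries.ringHom.comp
    (MvPolynomial.map (Polynomial.aeval C : Polynomial ℚ →ₐ[ℚ] ℝ).toRingHom)

theorem specializeHom_apply (C : ℝ) (P : MvPolynomial (Fin 2) (Polynomial ℚ)) :
    specializeHom C P = (specialize C P : Series) := rfl

/-- The families of power series, depending on a parameter `C > 0`, that are quotients of
polynomials in `x, y, C` with a denominator whose constant term in `x, y` has no positive zero. -/
def rationalFamilies : Subring (Pos → Series) where
  carrier := {f | ∃ P Q : MvPolynomial (Fin 2) (Polynomial ℚ), ∀ C : Pos,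
    MvPowerSeries.constantCoeff (specializeHom C Q) ≠ 0 ∧
      specializeHom C Q * f C = specializeHom C P}
  zero_mem' := ⟨0, 1, fun C => by simp⟩
  one_mem' := ⟨1, 1, fun C => by simp⟩
  neg_mem' := by
    rintro f ⟨P, Q, h⟩
    exact ⟨-P, Q, fun C => ⟨(h C).1, by simp [(h C).2]⟩⟩
  mul_mem' := by
    rintro f g ⟨P, Q, h⟩ ⟨P', Q', h'⟩
    refine ⟨P * P', Q * Q', fun C => ⟨?_, ?_⟩⟩
    · simpa using ⟨(h C).1, (h' C).1⟩
    · rw [map_mul, map_mul, ← (h C).2, ← (h' C).2, Pi.mul_apply]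
      ring
  add_mem' := by
    rintro f g ⟨P, Q, h⟩ ⟨P', Q', h'⟩
    refine ⟨P * Q' + P' * Q, Q * Q', fun C => ⟨?_, ?_⟩⟩
    · simpa using ⟨(h C).1, (h' C).1⟩
    · rw [map_mul, map_add, map_mul, map_mul, ← (h C).2, ← (h' C).2, Pi.add_apply]
      ring

theorem mem_rationalFamilies_of_mul_eq {f g k : Pos → Series} (hg : g ∈ rationalFamilies)
    (hk : k ∈ rationalFamilies) (h : g * f = k)
    (h0 : ∀ C, MvPowerSeries.constantCoeff (g C) ≠ 0) : f ∈ rationalFamilies := by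
  obtain ⟨P, Q, hPQ⟩ := hg
  obtain ⟨P', Q', hPQ'⟩ := hk
  -- This is (P'/Q')/(P/Q). The constant coefficient of P is nonzero because P = Qg.
  refine ⟨Q * P', Q' * P, fun C => ⟨?_, ?_⟩⟩
  · rw [map_mul, map_mul, ← (hPQ C).2, map_mul]
    exact mul_ne_zero (hPQ' C).1 (mul_ne_zero (hPQ C).1 (h0 C))
  · rw [map_mul, map_mul, ← (hPQ C).2, ← (hPQ' C).2, ← h, Pi.mul_apply]
    ring

theorem const_X_mem (i : Fin 2) :
    (fun _ => MvPowerSeries.X i : Pos → Series) ∈ rationalFamilies := by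
  refine ⟨MvPolynomial.X i, 1, fun C => ⟨by simp, ?_⟩⟩
  simp [specializeHom_apply, specialize]

/-- A linear system of the form `R = b + y w R` has a rational solution. -/
theorem mem_rationalFamilies_of_linear_system {ι : Type*} [Fintype ι] [DecidableEq ι]
    (R b : ι → Pos → Series) (w : ι → ι → Pos → Series) (hb : ∀ i, b i ∈ rationalFamilies)
    (hw : ∀ i j, w i j ∈ rationalFamilies)
    (h : ∀ i C, R i C = b i C + MvPowerSeries.X 1 * ∑ j, w i j C * R j C) (i : ι) :
    R i ∈ rationalFamilies := by
  set K := rationalFamilies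
  let X : K := ⟨fun _ => MvPowerSeries.X 1, const_X_mem 1⟩
  let W : Matrix ι ι K := Matrix.of fun i j => ⟨w i j, hw i j⟩
  let M : Matrix ι ι K := 1 - X • W
  let b' : ι → K := fun i => ⟨b i, hb i⟩
  have h1 : (K.subtype.mapMatrix M).mulVec R = fun i => b i := by
    have h2 : K.subtype.mapMatrix M = 1 - (X : Pos → Series) • Matrix.of w := by
      rw [map_sub, map_one]
      rfl
    rw [h2, Matrix.sub_mulVec, Matrix.one_mulVec, Matrix.smul_mulVec]
    ext1 i
    ext1 C
    simp only [Pi.sub_apply, Pi.smul_apply, smul_eq_mul, Pi.mul_apply, Matrix.mulVec, dotProduct,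
      Finset.sum_apply, Matrix.of_apply]
    rw [h i C]
    simp [X]
  -- Cramer's rule: multiplying by the adjugate, formed inside the subring, isolates each unknown.
  have h2 : (K.subtype M.det) • R = fun i => K.subtype ((M.adjugate.mulVec b') i) := by
    have h3 := congrArg (fun v => (K.subtype.mapMatrix M).adjugate.mulVec v) h1
    simp only [Matrix.mulVec_mulVec, Matrix.adjugate_mul, Matrix.smul_mulVec,
      Matrix.one_mulVec] at h3
    rw [RingHom.map_det, h3, ← RingHom.map_adjugate]
    ext1 i
    rw [RingHom.map_mulVec]
    rfl
  refine mem_rationalFamilies_of_mul_eq (g := K.subtype M.det) (M.det).2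
    ((M.adjugate.mulVec b') i).2 (congrFun h2 i) fun C => ?_
  -- Taking constant coefficients kills y, so 1 - yW becomes the identity matrix.
  have h4 : MvPowerSeries.constantCoeff (K.subtype M.det C) = 1 := by
    let φ : K →+* ℝ := (MvPowerSeries.constantCoeff.comp (Pi.evalRingHom _ C)).comp K.subtype
    have hX : φ X = 0 := MvPowerSeries.constantCoeff_X _
    change φ M.det = 1
    rw [RingHom.map_det, map_sub, map_one]
    have h5 : φ.mapMatrix (X • W) = 0 := by
      ext i j
      simp [hX]
    rw [h5, sub_zero, Matrix.det_one]
  rw [h4]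
  exact one_ne_zero

/-- Families of real numbers as families of constant power series. -/
def constHom : (Pos → ℝ) →+* (Pos → Series) := (MvPowerSeries.C (σ := Fin 2) (R := ℝ)).compLeft Pos

/-- The rational families of real numbers. -/
def rationalConsts : Subring (Pos → ℝ) := rationalFamilies.comap constHom

theorem mem_rationalConsts {c : Pos → ℝ} :
    c ∈ rationalConsts ↔ (fun C => MvPowerSeries.C (c C) : Pos → Series) ∈ rationalFamilies :=
  Iff.rfl

theorem div_mem_rationalConsts {a b : Pos → ℝ} (ha : a ∈ rationalConsts)
    (hb : b ∈ rationalConsts) (h0 : ∀ C, b C ≠ 0) : (fun C => a C / b C) ∈ rationalConsts := by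
  refine mem_rationalFamilies_of_mul_eq hb ha ?_ fun C => ?_
  · rw [← map_mul]
    congr 1
    ext C
    exact mul_div_cancel₀ _ (h0 C)
  · simpa [constHom] using h0 C

theorem parameter_mem : (fun C : Pos => (C : ℝ)) ∈ rationalConsts := by
  refine ⟨MvPolynomial.C Polynomial.X, 1, fun C => ⟨by simp, ?_⟩⟩
  simp [specializeHom_apply, specialize, constHom]

/-! ### Rationality in `C` of the local weights -/

theorem latticeEnergy_mem (A : List (ℤ × ℤ)) (v w : ℤ × ℤ) :
    (fun C : Pos => latticeEnergy C A v w) ∈ rationalConsts :=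
  pow_mem parameter_mem _

/-- The denominator is a sum of powers of C, positive unless empty; in the empty case division by
zero makes the quotient 0. -/
theorem latticeStep_mem (S : Set (ℤ × ℤ)) (A : List (ℤ × ℤ)) (v w : ℤ × ℤ) :
    (fun C : Pos => latticeStep S C A v w) ∈ rationalConsts := by
  rcases (freeDirs S A v).eq_empty_or_nonempty with h | h
  · have : (fun C : Pos => latticeStep S C A v w) = 0 := by
      ext C
      simp [latticeStep, h]
    rw [this]
    exact zero_mem _
  · refine div_mem_rationalConsts (latticeEnergy_mem A v w) ?_ fun C => ?_
    · have := sum_mem (S := rationalConsts) fun e (_ : e ∈ freeDirs S A v) =>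
        latticeEnergy_mem A v (v + e)
      convert this using 1
      ext C
      simp
    · exact (Finset.sum_pos (fun e _ => pow_pos C.2 _) h).ne'

theorem pointWeight_mem (S : Set (ℤ × ℤ)) (p : List (ℤ × ℤ)) (v : ℤ × ℤ) (q : List (ℤ × ℤ)) :
    (fun C : Pos => pointWeight S C p v q) ∈ rationalConsts := by
  cases q with
  | nil =>
    simp only [pointWeight]
    split_ifs
    · exact one_mem _
    · exact zero_mem _
  | cons w q => exact latticeStep_mem _ _ _ _

theorem scanProd_apply {α β M : Type*} [CommMonoid M] (g : List α → α → List α → β → M)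
    (q p : List α) (b : β) : scanProd g p q b = scanProd (fun p v q => g p v q b) p q := by
  induction q generalizing p with
  | nil => rfl
  | cons v q ih => simp [scanProd, ih]

theorem windowWeight_mem (S : Set (ℤ × ℤ)) (J : Finset ℤ) (t : List (ℤ × ℤ)) :
    (fun C : Pos => windowWeight S J C t) ∈ rationalConsts := by
  have : (fun C : Pos => windowWeight S J C t) =
      scanProd (fun p v q (C : Pos) => if v.1 ∈ J then pointWeight S C p v q else 1) [] t := by
    ext C
    rw [scanProd_apply]
    rfl
  rw [this]
  refine scanProd_mem rationalConsts _ _ _ fun p v q => ?_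
  split_ifs
  · exact pointWeight_mem S p v q
  · exact one_mem _

theorem monomial_mem {c : Pos → ℝ} (hc : c ∈ rationalConsts) (a : ℕ) :
    (fun C => MvPowerSeries.monomial (Finsupp.single 0 a) (c C) : Pos → Series) ∈
      rationalFamilies := by
  have h := mul_mem (mem_rationalConsts.1 hc) (pow_mem (const_X_mem 0) a)
  convert h using 1
  ext1 C
  rw [Pi.mul_apply, Pi.pow_apply, MvPowerSeries.X_pow_eq,
    ← MvPowerSeries.monomial_zero_eq_C_apply, MvPowerSeries.monomial_mul_monomial, zero_add,
    mul_one]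

/-! ### The transfer matrix -/

/-- The number of points of a list in the columns from `2` on. -/
def bulkCount (r : List (ℤ × ℤ)) : ℕ := r.countP fun v => 2 ≤ v.1

/-- The generating function of the traces with restriction `s` to the columns up to `3`. -/
def traceGF (h : ℕ) (s : List (ℤ × ℤ)) (C : ℝ) : Series := fun d =>
  ∑ r ∈ traces h (LeftRel 0) (0, -1) (d 1) with upTo 3 r = s,
    if bulkCount r = d 0 then traceWeight h C r else 0

theorem coeff_traceGF (h : ℕ) (s : List (ℤ × ℤ)) (C : ℝ) (d : Fin 2 →₀ ℕ) :
    MvPowerSeries.coeff d (traceGF h s C) =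
      ∑ r ∈ traces h (LeftRel 0) (0, -1) (d 1) with upTo 3 r = s,
        if bulkCount r = d 0 then traceWeight h C r else 0 := rfl

theorem coeff_monomial_mul_traceGF (h : ℕ) (s : List (ℤ × ℤ)) (C c : ℝ) (a : ℕ)
    (d : Fin 2 →₀ ℕ) :
    MvPowerSeries.coeff d (MvPowerSeries.monomial (Finsupp.single 0 a) c * traceGF h s C) =
      ∑ r ∈ traces h (LeftRel 0) (0, -1) (d 1) with upTo 3 r = s,
        if a + bulkCount r = d 0 then c * traceWeight h C r else 0 := by
  rw [MvPowerSeries.coeff_monomial_mul, if_congr Finsupp.single_le_iff rfl rfl]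
  split_ifs with ha
  · rw [coeff_traceGF, Finset.mul_sum]
    have h1 : (d - Finsupp.single 0 a : Fin 2 →₀ ℕ) 1 = d 1 := by simp
    have h0 : (d - Finsupp.single 0 a : Fin 2 →₀ ℕ) 0 = d 0 - a := by simp
    rw [h1, h0]
    refine Finset.sum_congr rfl fun r _ => ?_
    rw [mul_ite, mul_zero]
    exact if_congr (by omega) rfl rfl
  · symm
    refine Finset.sum_eq_zero fun r _ => if_neg (by omega)

theorem traces_zero {h : ℕ} {R : ℤ × ℤ → ℤ × ℤ → Prop} {m : ℤ × ℤ} : traces h R m 0 = {[]} := by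
  ext r
  rw [mem_traces, mem_singleton]
  constructor
  · rintro ⟨h1, h2, _⟩
    refine List.eq_nil_iff_forall_not_mem.2 fun v hv => ?_
    have := h2 v hv
    have := (h1.mem v hv).1
    push_cast at *
    omega
  · rintro rfl
    exact ⟨⟨by simp, by simp, by simp⟩, by simp, by simp⟩

/-- The empty trace gives the constant term. Otherwise removing column 0 lowers the extent by one,
whence the factor y, and the points of column 2 are charged to x. -/
theorem traceGF_eq (h : ℕ) (s : List (ℤ × ℤ)) (C : ℝ) :
    traceGF h s C = (if s = [] then 1 else 0) + MvPowerSeries.X 1 *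
      ∑ t ∈ windows h (LeftRel 0) (0, -1) with upTo 3 t = s,
        MvPowerSeries.monomial (Finsupp.single 0 (t.countP fun v => v.1 = 2))
          (windowWeight (fullStrip h) {2} C t) * traceGF h (next t) C := by
  ext d
  rw [map_add, MvPowerSeries.X_def, MvPowerSeries.coeff_monomial_mul,
    if_congr Finsupp.single_le_iff rfl rfl, one_mul]
  rcases hd : d 1 with _ | k
  · rw [if_neg (show ¬ 1 ≤ 0 by omega), add_zero, coeff_traceGF, hd, traces_zero, sum_filter, sum_singleton]
    have h1 : upTo 3 ([] : List (ℤ × ℤ)) = s ↔ s = [] := eq_comm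
    have h2 : bulkCount ([] : List (ℤ × ℤ)) = d 0 ↔ d = 0 := by
      rw [Finsupp.ext_iff, Fin.forall_fin_two]
      simp [bulkCount, hd, eq_comm]
    rw [if_congr h1 rfl rfl, if_congr h2 rfl rfl]
    split_ifs with h3 h4
    · simp [MvPowerSeries.coeff_one, h4, traceWeight, scanProd]
    · simp [MvPowerSeries.coeff_one, h4]
    · simp
  · have h1 : MvPowerSeries.coeff d (if s = [] then 1 else 0 : Series) = 0 := by
      split_ifs
      · rw [MvPowerSeries.coeff_one, if_neg]
        rintro rfl
        simp at hd
      · simp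
    have h2 : (d - Finsupp.single 1 1 : Fin 2 →₀ ℕ) 1 = k := by simp [hd]
    have h3 : (d - Finsupp.single 1 1 : Fin 2 →₀ ℕ) 0 = d 0 := by simp
    rw [if_pos (show 1 ≤ k + 1 by omega), h1, zero_add, map_sum]
    simp only [coeff_monomial_mul_traceGF, h2, h3]
    rw [coeff_traceGF, hd, sum_filter, sum_filter]
    have h4 := sum_traces_succ (h := h) isStepRel_leftRel (m := (0, -1)) rfl k fun t r =>
      if upTo 3 t = s then
        (if (t.countP fun v => v.1 = 2) + bulkCount r = d 0 then
          windowWeight (fullStrip h) {2} C t * traceWeight h C r else 0) else 0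
    refine Eq.trans (Finset.sum_congr rfl fun r hr => ?_) (h4.trans ?_)
    · rw [upTo_three_upTo, bulkCount, bulkCount, countP_two_le r,
        traceWeight_eq C (mem_traces.1 hr).1]
    · refine Finset.sum_congr rfl fun t _ => ?_
      split_ifs <;> simp

/-- No factor y appears, because displacement is extent minus one; likewise edges are points minus
one, whence the `- 1` in the exponent of x. -/
theorem energeticGF_eq (h : ℕ) (hh : 1 ≤ h) (C : ℝ) :
    energeticGF h hh C = ∑ t ∈ windows h GridAdj (0, (h : ℤ)),
      MvPowerSeries.monomial (Finsupp.single 0 ((t.countP fun v => v.1 ≤ 2) - 1))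
        (windowWeight (strip h) {0, 1, 2} C t) * traceGF h (next t) C := by
  ext d
  rw [map_sum]
  simp only [coeff_monomial_mul_traceGF]
  refine (energeticGF_apply h hh C d).trans ?_
  have h4 := sum_traces_succ (h := h) isStepRel_gridAdj (m := (0, (h : ℤ))) rfl (d 1) fun t r =>
      if (t.countP fun v => v.1 ≤ 2) + bulkCount r = d 0 + 1 then
        windowWeight (strip h) {0, 1, 2} C t * traceWeight h C r else 0
  rw [sum_filter]
  refine Eq.trans (Finset.sum_congr rfl fun r hr => ?_) (h4.trans ?_)
  · rw [bulkCount, ← length_eq_countP, scanProd_pointWeight_strip C (mem_traces.1 hr).1]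
  · refine Finset.sum_congr rfl fun t ht => Finset.sum_congr rfl fun r _ => ?_
    -- Positivity makes the truncated subtraction in the exponent exact.
    have hpos : 0 < t.countP fun v => v.1 ≤ 2 := by
      obtain ⟨_, _, hc, hne⟩ := mem_windows.1 ht
      obtain ⟨v, t, rfl⟩ := List.exists_cons_of_ne_nil hne
      rw [List.countP_pos_iff]
      refine ⟨v, by simp, ?_⟩
      rcases (List.isChain_cons_cons.1 hc).1 with h1 | h1
      · have := h1.fst_le
        simp only [decide_eq_true_eq]
        omega
      · simp at h1
    exact if_congr (by omega) rfl rfl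

theorem finite_states (h : ℕ) :
    {s : List (ℤ × ℤ) | s.Nodup ∧ ∀ v ∈ s, v ∈ {v : ℤ × ℤ | v ∈ strip h ∧ v.1 < 4}}.Finite :=
  finite_nodup_lists (finite_strip_lt h 4)

/-- The possible restrictions of traces to the columns up to `3`. -/
def states (h : ℕ) : Finset (List (ℤ × ℤ)) := (finite_states h).toFinset

theorem IsWindow.next_mem_states {h R m t} (ht : IsWindow h R m t) : next t ∈ states h := by
  simp only [states, Set.Finite.mem_toFinset, Set.mem_ofPred_eq]
  refine ⟨(ht.nodup.filter _).map shift_injective, fun v hv => ?_⟩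
  rw [mem_next] at hv
  have := ht.mem _ hv.1
  simp only [strip, Set.mem_ofPred_eq, unshift_fst, unshift_snd] at this ⊢
  omega

theorem traceGF_mem (h : ℕ) (s : List (ℤ × ℤ)) (hs : s ∈ states h) :
    (fun C : Pos => traceGF h s C) ∈ rationalFamilies := by
  classical
  refine mem_rationalFamilies_of_linear_system (ι := states h)
    (fun s C => traceGF h s C) (fun s _ => if s.1 = [] then 1 else 0)
    (fun s s' => ∑ t ∈ windows h (LeftRel 0) (0, -1) with upTo 3 t = s ∧ next t = s',
      fun C => MvPowerSeries.monomial (Finsupp.single 0 (t.countP fun v => v.1 = 2))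
          (windowWeight (fullStrip h) {2} C t)) (fun s => ?_) (fun s s' => ?_) (fun s C => ?_)
    ⟨s, hs⟩
  · split_ifs
    · exact one_mem _
    · exact zero_mem _
  · exact sum_mem fun t _ => monomial_mem (windowWeight_mem _ _ _) _
  · rw [traceGF_eq]
    congr 2
    simp only [Finset.sum_apply, Finset.sum_mul]
    simp_rw [← Finset.filter_filter]
    rw [Finset.sum_coe_sort (states h) fun s' => ∑ t ∈ {t ∈ {t ∈ windows h (LeftRel 0) (0, -1) |
      upTo 3 t = s.1} | next t = s'}, MvPowerSeries.monomial
        (Finsupp.single 0 (t.countP fun v => v.1 = 2))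
          (windowWeight (fullStrip h) {2} C t) * traceGF h s' C]
    -- Grouping the windows by the state they lead to turns the recursion into a matrix-vector
    -- product.
    rw [← Finset.sum_fiberwise_of_maps_to (t := states h) (g := next) fun t ht =>
      (mem_windows.1 (mem_filter.1 ht).1).next_mem_states]
    refine Finset.sum_congr rfl fun s' _ => Finset.sum_congr rfl fun t ht => ?_
    rw [(mem_filter.1 ht).2]

theorem energeticGF_mem (h : ℕ) (hh : 1 ≤ h) :
    (fun C : Pos => energeticGF h hh C) ∈ rationalFamilies := by
  have h1 := sum_mem (S := rationalFamilies)
    fun t (ht : t ∈ windows h GridAdj (0, (h : ℤ))) =>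
      mul_mem (monomial_mem (windowWeight_mem (strip h) {0, 1, 2} t)
        ((t.countP fun v => v.1 ≤ 2) - 1)) (traceGF_mem h _ (mem_windows.1 ht).next_mem_states)
  convert h1 using 1
  ext1 C
  rw [energeticGF_eq, Finset.sum_apply]
  rfl

end GSAW

end

/-- The generating function is the power series expansion of a single rational function `P / Q` of
the three variables `x, y, C`, whose denominator is invertible as a power series in `x, y` for
every positive constant `C`. -/
theorem mainTheorem4 (h : ℕ) (hh : 1 ≤ h) :
    ∃ P Q : MvPolynomial (Fin 2) (Polynomial ℚ), ∀ C : ℝ, 0 < C →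
      MvPolynomial.constantCoeff (GSAW.specialize C Q) ≠ 0 ∧
      (GSAW.specialize C Q : MvPowerSeries (Fin 2) ℝ) * GSAW.energeticGF h hh C =
        (GSAW.specialize C P : MvPowerSeries (Fin 2) ℝ) := by
  obtain ⟨P, Q, hPQ⟩ := GSAW.energeticGF_mem h hh
  refine ⟨P, Q, fun C hC => ⟨?_, (hPQ ⟨C, hC⟩).2⟩⟩
  have h1 := (hPQ ⟨C, hC⟩).1
  rw [GSAW.specializeHom_apply, ← MvPowerSeries.coeff_zero_eq_constantCoeff_apply,
    MvPolynomial.coeff_coe] at h1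
  exact h1
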